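/- Let $M$ be a connected smooth manifold of dimension $6$ with a smooth $SU(3)$-structure $(g,J,\Psi)$: $g$ is a Riemannian metric, $J$ an almost complex structure with $g(JX,JY)=g(X,Y)$, and $\Psi=\Psi^++\sqrt{-1}\,\Psi^-$ a complex $3$-form such that around every point there is a local orthonormal coframe $e_1,\dots,e_6$ (identified with its dual frame) with $Je_1=e_2$, $Je_3=e_4$, $Je_5=e_6$ and $\Psi=-(e_1+\sqrt{-1}e_2)\wedge(e_3+\sqrt{-1}e_4)\wedge(e_5+\sqrt{-1}e_6)$. Suppose that $(M,g,J,\Psi)$ is an almost Calabi--Yau manifold with torsion (ACYT), i.e. there is a (necessarily unique) linear connection $\nabla$, the torsion connection, with $\nabla g=\nabla J=\nabla\Psi^+=\nabla\Psi^-=0$ whose torsion $T(X,Y)=\nabla_XY-\nabla_YX-[X,Y]$ is totally skew-symmetric, i.e. $g(T(X,Y),Z)=-g(T(X,Z),Y)$. Let $N(X,Y)=[JX,JY]-[X,Y]-J[JX,Y]-J[X,JY]$ be the Nijenhuis tensor, $\|N\|^2=\sum_{i,j,k}g(N(e_i,e_j),e_k)^2$ for an orthonormal frame, $F(X,Y)=g(X,JY)$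 the K\"ahler form, and $\theta(X)=(\delta F)(JX)$ the Lee form, where $\delta$ is the codifferential of $g$, $(\delta F)(X)=-\sum_i(\nabla^g_{e_i}F)(e_i,X)$ with $\nabla^g$ the Levi-Civita connection. Then the following conditions are equivalent: a) $d\theta$ is $J$-invariant: $d\theta(X,Y)=d\theta(JX,JY)$ for all $X,Y$; b) $\|N\|^2$ is constant on $M$; c) $\nabla N=0$. In particular, if $(M,g,J,\Psi)$ is a Calabi--Yau manifold with torsion (CYT), i.e. ACYT with $N=0$, then the $2$-form $d\theta$ is of type $(1,1)$ with respect to $J$. -/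

import Mathlib

open Bundle
open scoped Manifold ContDiff InnerProductSpace

noncomputable section

/-- The tangent space at `x` of a manifold modelled on `ℝ⁶`. -/
abbrev Tan {M : Type*} [TopologicalSpace M] [ChartedSpace (EuclideanSpace ℝ (Fin 6)) M]
    (x : M) : Type :=
  TangentSpace (𝓡 6) x

namespace SU3Torsion

variable {M : Type*} [TopologicalSpace M] [ChartedSpace (EuclideanSpace ℝ (Fin 6)) M]

/-- Extension of a tangent vector at `x` to a vector field which is smooth near `x`
(constant in a trivialization of the tangent bundle around `x`). The tensors below are
`C^∞`-linear expressions in vector fields, evaluated on such extensions. -/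
def ext [IsManifold (𝓡 6) ∞ M] {x : M} (v : Tan x) : Π y : M, Tan y :=
  FiberBundle.extend (EuclideanSpace ℝ (Fin 6)) v

/-- The Lie derivative `v(f)` of a function along a tangent vector. -/
def dirDeriv {V : Type*} [NormedAddCommGroup V] [NormedSpace ℝ V] (f : M → V) (x : M)
    (v : Tan x) : V :=
  mvfderiv (𝓡 6) f x v

/-- Differentiability of a vector field at a point. -/
def DiffAt [IsManifold (𝓡 6) ∞ M] (X : Π y : M, Tan y) (x : M) : Prop :=
  MDifferentiableAt (𝓡 6) ((𝓡 6).prod 𝓘(ℝ, EuclideanSpace ℝ (Fin 6)))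
    (fun y ↦ TotalSpace.mk' (EuclideanSpace ℝ (Fin 6)) y (X y)) x

/-- Smoothness of a vector field at a point. -/
def SmoothAt [IsManifold (𝓡 6) ∞ M] (X : Π y : M, Tan y) (x : M) : Prop :=
  ContMDiffAt (𝓡 6) ((𝓡 6).prod 𝓘(ℝ, EuclideanSpace ℝ (Fin 6))) ∞
    (fun y ↦ TotalSpace.mk' (EuclideanSpace ℝ (Fin 6)) y (X y)) x

/-- Smoothness of a field of endomorphisms of the tangent bundle. -/
def SmoothEnd [IsManifold (𝓡 6) ∞ M] (J : Π x : M, Tan x →L[ℝ] Tan x) : Prop :=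
  ContMDiff (𝓡 6)
    ((𝓡 6).prod 𝓘(ℝ, EuclideanSpace ℝ (Fin 6) →L[ℝ] EuclideanSpace ℝ (Fin 6))) ∞
    (fun x ↦ TotalSpace.mk' (EuclideanSpace ℝ (Fin 6) →L[ℝ] EuclideanSpace ℝ (Fin 6))
      (E := fun x : M ↦ Tan x →L[ℝ] Tan x) x (J x))

/-! ### Nijenhuis tensor and exterior derivative of a 1-form -/

section Smooth

variable [IsManifold (𝓡 6) ∞ M]

/-- `[JX,JY] - [X,Y] - J[JX,Y] - J[X,JY]`. -/
def nijenhuisField (J : Π x : M, Tan x →L[ℝ] Tan x) (X Y : Π y : M, Tan y) (x : M) : Tan x :=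
  VectorField.mlieBracket (𝓡 6) (fun y ↦ J y (X y)) (fun y ↦ J y (Y y)) x
    - VectorField.mlieBracket (𝓡 6) X Y x
    - J x (VectorField.mlieBracket (𝓡 6) (fun y ↦ J y (X y)) Y x)
    - J x (VectorField.mlieBracket (𝓡 6) X (fun y ↦ J y (Y y)) x)

/-- The Nijenhuis tensor `N` of `J`. -/
def nijenhuis (J : Π x : M, Tan x →L[ℝ] Tan x) (x : M) (u v : Tan x) : Tan x :=
  nijenhuisField J (ext u) (ext v) x

/-- Exterior derivative of a 1-form, `dθ(X,Y) = X(θ(Y)) - Y(θ(X)) - θ([X,Y])`. -/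
def extDerivOne (θ : Π x : M, Tan x → ℝ) (x : M) (u v : Tan x) : ℝ :=
  dirDeriv (fun y ↦ θ y (ext v y)) x u - dirDeriv (fun y ↦ θ y (ext u y)) x v
    - θ x (VectorField.mlieBracket (𝓡 6) (ext u) (ext v) x)

/-- The covariant derivative of a `(1,2)`-tensor `N` vanishes:
`∇_v (N(Y,Z)) = N(∇_v Y, Z) + N(Y, ∇_v Z)`. -/
def IsParallelTwoTensor
    (cov : CovariantDerivative (𝓡 6) (EuclideanSpace ℝ (Fin 6)) (fun x : M ↦ Tan x))
    (N : Π x : M, Tan x → Tan x → Tan x) : Prop :=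
  ∀ (x : M) (v : Tan x) (Y Z : Π y : M, Tan y), DiffAt Y x → DiffAt Z x →
    cov (fun y ↦ N y (Y y) (Z y)) x v - N x (cov Y x v) (Z x) - N x (Y x) (cov Z x v) = 0

/-- The covariant derivative of an endomorphism field vanishes: `∇_v (JY) = J ∇_v Y`. -/
def IsParallelEnd
    (cov : CovariantDerivative (𝓡 6) (EuclideanSpace ℝ (Fin 6)) (fun x : M ↦ Tan x))
    (J : Π x : M, Tan x →L[ℝ] Tan x) : Prop :=
  ∀ (x : M) (v : Tan x) (Y : Π y : M, Tan y), DiffAt Y x →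
    cov (fun y ↦ J y (Y y)) x v - J x (cov Y x v) = 0

/-- The covariant derivative of a complex-valued 3-form vanishes (equivalently, its real and
imaginary parts are parallel). -/
def IsParallelForm
    (cov : CovariantDerivative (𝓡 6) (EuclideanSpace ℝ (Fin 6)) (fun x : M ↦ Tan x))
    (Ψ : Π x : M, Tan x [⋀^Fin 3]→L[ℝ] ℂ) : Prop :=
  ∀ (x : M) (v : Tan x) (Y : Fin 3 → Π y : M, Tan y), (∀ k, DiffAt (Y k) x) →
    dirDeriv (fun y ↦ Ψ y (fun k ↦ Y k y)) x v
      - ∑ k, Ψ x (Function.update (fun l ↦ Y l x) k (cov (Y k) x v)) = 0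

/-- Smoothness of a complex-valued 3-form: it is smooth on smooth vector fields. -/
def SmoothForm (Ψ : Π x : M, Tan x [⋀^Fin 3]→L[ℝ] ℂ) : Prop :=
  ∀ (x : M) (Y : Fin 3 → Π y : M, Tan y), (∀ k, SmoothAt (Y k) x) →
    ContMDiffAt (𝓡 6) 𝓘(ℝ, ℂ) ∞ (fun y ↦ Ψ y (fun k ↦ Y k y)) x

/-- A real 2-form at `x` is of type `(1,1)` with respect to `J`: its complex bilinear extension
vanishes on pairs of `(1,0)`-vectors `u - iJu`, `v - iJv` (hence, by conjugation, on pairs of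
`(0,1)`-vectors). -/
def IsTypeOneOne {x : M} (J : Tan x →L[ℝ] Tan x) (β : Tan x → Tan x → ℝ) : Prop :=
  ∀ u v : Tan x,
    ((β u v - β (J u) (J v) : ℝ) : ℂ) - Complex.I * ((β (J u) v + β u (J v) : ℝ) : ℂ) = 0

end Smooth

/-! ### Riemannian geometry -/

section Riemannian

variable [IsManifold (𝓡 6) ∞ M] [RiemannianBundle (fun x : M ↦ Tan x)]

/-- An orthonormal basis of the tangent space. -/
def onb (x : M) : OrthonormalBasis (Fin (Module.finrank ℝ (Tan x))) ℝ (Tan x) :=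
  haveI : FiniteDimensional ℝ (Tan x) :=
    inferInstanceAs (FiniteDimensional ℝ (EuclideanSpace ℝ (Fin 6)))
  stdOrthonormalBasis ℝ (Tan x)

/-- The Koszul expression for `g(∇^g_X Y, Z)`. -/
def koszul (X Y Z : Π y : M, Tan y) (x : M) : ℝ :=
  (1 / 2 : ℝ) *
    (dirDeriv (fun y ↦ ⟪Y y, Z y⟫_ℝ) x (X x) + dirDeriv (fun y ↦ ⟪X y, Z y⟫_ℝ) x (Y x)
      - dirDeriv (fun y ↦ ⟪X y, Y y⟫_ℝ) x (Z x)
      + ⟪VectorField.mlieBracket (𝓡 6) X Y x, Z x⟫_ℝ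
      - ⟪VectorField.mlieBracket (𝓡 6) X Z x, Y x⟫_ℝ
      - ⟪VectorField.mlieBracket (𝓡 6) Y Z x, X x⟫_ℝ)

/-- The Levi-Civita connection: `∇^g_v Y` at `x`, through the Koszul formula. -/
def leviCivita (Y : Π y : M, Tan y) (x : M) (v : Tan x) : Tan x :=
  ∑ i, koszul (ext v) Y (ext (onb x i)) x • onb x i

/-- `(∇^g_v β)(u, w)` for a 2-form `β`. -/
def leviCivitaForm (β : Π x : M, Tan x → Tan x → ℝ) (x : M) (v u w : Tan x) : ℝ :=
  dirDeriv (fun y ↦ β y (ext u y) (ext w y)) x v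
    - β x (leviCivita (ext u) x v) w - β x u (leviCivita (ext w) x v)

/-- The codifferential of a 2-form, `(δβ)(w) = - ∑ᵢ (∇^g_{eᵢ} β)(eᵢ, w)`. -/
def codiffTwo (β : Π x : M, Tan x → Tan x → ℝ) (x : M) (w : Tan x) : ℝ :=
  - ∑ i, leviCivitaForm β x (onb x i) (onb x i) w

/-- The Kähler form `F(X,Y) = g(X,JY)`. -/
def kahlerForm (J : Π x : M, Tan x →L[ℝ] Tan x) (x : M) (u v : Tan x) : ℝ :=
  ⟪u, J x v⟫_ℝ

/-- The Lee form `θ(X) = (δF)(JX)`. -/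
def leeForm (J : Π x : M, Tan x →L[ℝ] Tan x) (x : M) (v : Tan x) : ℝ :=
  codiffTwo (kahlerForm J) x (J x v)

/-- `‖N‖² = ∑ g(N(eᵢ,eⱼ),eₖ)²`. -/
def normSqTensor (N : Π x : M, Tan x → Tan x → Tan x) (x : M) : ℝ :=
  ∑ i, ∑ j, ∑ k, ⟪N x (onb x i) (onb x j), onb x k⟫_ℝ ^ 2

/-- `(g, J, Ψ)` is an `SU(3)`-structure: `J` is a smooth `g`-orthogonal almost complex structure
and `Ψ` is a smooth complex 3-form which at each point equals
`-(e₁ + i e₂) ∧ (e₃ + i e₄) ∧ (e₅ + i e₆)` in some orthonormal coframe with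
`J e₁ = e₂`, `J e₃ = e₄`, `J e₅ = e₆` (so that `F = -e₁₂ - e₃₄ - e₅₆`). -/
structure IsSU3Structure (J : Π x : M, Tan x →L[ℝ] Tan x)
    (Ψ : Π x : M, Tan x [⋀^Fin 3]→L[ℝ] ℂ) : Prop where
  smooth_J : SmoothEnd J
  J_sq : ∀ (x : M) (v : Tan x), J x (J x v) = -v
  J_inner : ∀ (x : M) (u v : Tan x), ⟪J x u, J x v⟫_ℝ = ⟪u, v⟫_ℝ
  smooth_Ψ : SmoothForm Ψ
  adapted : ∀ x : M, ∃ e : OrthonormalBasis (Fin 3 × Fin 2) ℝ (Tan x),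
    (∀ j, J x (e (j, 0)) = e (j, 1)) ∧
    ∀ v : Fin 3 → Tan x, Ψ x v =
      - Matrix.det (Matrix.of fun j k : Fin 3 ↦
          ((⟪e (j, 0), v k⟫_ℝ : ℝ) : ℂ) + Complex.I * ((⟪e (j, 1), v k⟫_ℝ : ℝ) : ℂ))

variable [IsContMDiffRiemannianBundle (𝓡 6) ∞ (EuclideanSpace ℝ (Fin 6)) (fun x : M ↦ Tan x)]

instance riemannianBundle_one :
    IsContMDiffRiemannianBundle (𝓡 6) 1 (EuclideanSpace ℝ (Fin 6)) (fun x : M ↦ Tan x) :=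
  IsContMDiffRiemannianBundle.of_le (n := ∞) (by norm_cast)

/-- `(M, g, J, Ψ)` is an almost Calabi-Yau manifold with torsion, with torsion connection `cov`:
`cov` is a smooth linear connection preserving `g`, `J` and `Ψ`, with totally skew-symmetric
torsion. -/
structure IsACYT (J : Π x : M, Tan x →L[ℝ] Tan x) (Ψ : Π x : M, Tan x [⋀^Fin 3]→L[ℝ] ℂ)
    (cov : CovariantDerivative (𝓡 6) (EuclideanSpace ℝ (Fin 6)) (fun x : M ↦ Tan x)) :
    Prop where
  su3 : IsSU3Structure J Ψ
  smooth_cov : CovariantDerivative.ContMDiffCovariantDerivative cov ∞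
  metric : cov.IsMetricCompatible
  torsion_skew : ∀ (x : M) (u v w : Tan x),
    ⟪cov.torsion x u v, w⟫_ℝ = - ⟪cov.torsion x u w, v⟫_ℝ
  parallel_J : IsParallelEnd cov J
  parallel_Ψ : IsParallelForm cov Ψ

/-- `(M, g, J, Ψ)` is a Calabi-Yau manifold with torsion: ACYT with integrable `J`. -/
structure IsCYT (J : Π x : M, Tan x →L[ℝ] Tan x) (Ψ : Π x : M, Tan x [⋀^Fin 3]→L[ℝ] ℂ)
    (cov : CovariantDerivative (𝓡 6) (EuclideanSpace ℝ (Fin 6)) (fun x : M ↦ Tan x)) :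
    Prop where
  acyt : IsACYT J Ψ cov
  integrable : ∀ (x : M) (u v : Tan x), nijenhuis J x u v = 0

end Riemannian

end SU3Torsion

end

/-! Write $T$ for the torsion 3-form of $\nabla$ and $Z_k=e_k-iJe_k$ in an adapted basis. Since $J$
is parallel, $N$ is an algebraic expression in $T$, namely the real part of $T(u-iJu,v-iJv,w-iJw)$.
The $(3,0)$-forms are spanned by $\Psi$, so $N=\mathrm{Re}(f\Psi)$ for a complex function $f$, and
$\|N\|^2=24|f|^2$ (`exists_coeff`). As $\nabla\Psi=0$, also $\nabla N=\mathrm{Re}(df\otimes\Psi)$,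
so c) says $df=0$ (`dirDeriv_coeff`, `coeffDeriv_eq_zero_iff_nijPart`).

The link with $\theta$ is the first Bianchi identity of a connection with torsion (`curv_bianchi`),
whose curvature takes values in $\mathfrak{su}(3)$. On $(Z_0,Z_1,Z_2;Z_2)$ the curvature terms
vanish by type and the terms quadratic in $T$ cancel; what remains is the Cauchy-Riemann equation
$df(Z_2)=0$ (`BianchiData.cauchyRiemann`). Summed over $(Z_0,Z_1,\bar Z_d;Z_d)$, the curvature drops
out because it is trace free. Because $\nabla^g=\nabla-\frac12T$, the Lee form is a trace of $T$, so
$d\theta$ involves $\nabla T$ and a quadratic term in $T$; comparison with the summed identity gives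
$d\theta(Z_0,Z_1)=df(e_2)$ (`BianchiData.part₂₀_eq`). Cyclic relabelling then shows that the
$(2,0)$-part of $d\theta$ vanishes exactly when $df=0$, which is a) ⇔ c).

If $|f|^2$ is constant, then $\mathrm{Re}(\bar f\,df)=0$; the Cauchy-Riemann equations
$df(Je_k)=-i\,df(e_k)$ make the imaginary part vanish on $e_k$ too, so $\bar f\,df=0$, and $f$ is
either nowhere zero or identically zero. Conversely $df=0$ makes $f$ constant on the connected $M$.
The CYT statement is the case of constant norm $0$. -/

noncomputable section

namespace SU3Torsion

/-! ### Complexified trilinear and 4-linear forms; quadratic identities for the torsion -/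

section Algebra

variable {V : Type*}

/-- Value of the complex trilinear extension of `t` on `u + a Ju`, `v + b Jv`, `w + c Jw`. -/
def cplx₃ (J : V → V) (t : V → V → V → ℝ) (u : V) (a : ℂ) (v : V) (b : ℂ) (w : V) (c : ℂ) : ℂ :=
  t u v w + a * t (J u) v w + b * t u (J v) w + c * t u v (J w)
    + a * b * t (J u) (J v) w + a * c * t (J u) v (J w) + b * c * t u (J v) (J w)
    + a * b * c * t (J u) (J v) (J w)

/-- Value of the complex 4-linear extension of `E` on `z + d Jz`, `u + a Ju`, `v + b Jv`,
`w + c Jw`. -/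
def cplx₄ (J : V → V) (E : V → V → V → V → ℝ) (z : V) (d : ℂ) (u : V) (a : ℂ) (v : V) (b : ℂ)
    (w : V) (c : ℂ) : ℂ :=
  cplx₃ J (E z) u a v b w c + d * cplx₃ J (E (J z)) u a v b w c

variable {J : V → V} {t : V → V → V → ℝ} {e : Fin 3 → V}

lemma cplx₃_swap₁₂ (h : ∀ u v w, t u v w = -t v u w) (u : V) (a : ℂ) (v : V) (b : ℂ) (w : V)
    (c : ℂ) : cplx₃ J t u a v b w c = -cplx₃ J t v b u a w c := by
  simp only [cplx₃]
  rw [h u v w, h (J u) v w, h u (J v) w, h u v (J w), h (J u) (J v) w, h (J u) v (J w),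
    h u (J v) (J w), h (J u) (J v) (J w)]
  push_cast
  ring

lemma cplx₃_swap₂₃ (h : ∀ u v w, t u v w = -t u w v) (u : V) (a : ℂ) (v : V) (b : ℂ) (w : V)
    (c : ℂ) : cplx₃ J t u a v b w c = -cplx₃ J t u a w c v b := by
  simp only [cplx₃]
  rw [h u v w, h (J u) v w, h u (J v) w, h u v (J w), h (J u) (J v) w, h (J u) v (J w),
    h u (J v) (J w), h (J u) (J v) (J w)]
  push_cast
  ring

/-- The sixteen real instances, each argument being a vector or its image under `J`, are added with
the weights of the complex extension; multilinearity plays no role. -/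
lemma cplx₄_bianchi {r E Q : V → V → V → V → ℝ}
    (h : ∀ u v w p, r u v w p + r v w u p + r w u v p
      = E u v w p + E v w u p + E w u v p + (Q u v w p + Q v w u p + Q w u v p))
    (u : V) (a : ℂ) (v : V) (b : ℂ) (w : V) (c : ℂ) (p : V) (d : ℂ) :
    cplx₄ J r u a v b w c p d + cplx₄ J r v b w c u a p d + cplx₄ J r w c u a v b p d
      = cplx₄ J E u a v b w c p d + cplx₄ J E v b w c u a p d + cplx₄ J E w c u a v b p d
        + (cplx₄ J Q u a v b w c p d + cplx₄ J Q v b w c u a p d + cplx₄ J Q w c u a v b p d) := by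
  have H : ∀ u v w p, (r u v w p : ℂ) + r v w u p + r w u v p
      = E u v w p + E v w u p + E w u v p + (Q u v w p + Q v w u p + Q w u v p) :=
    fun u v w p ↦ by exact_mod_cast h u v w p
  simp only [cplx₄, cplx₃]
  linear_combination H u v w p + a * H (J u) v w p + b * H u (J v) w p + c * H u v (J w) p
    + d * H u v w (J p) + a * b * H (J u) (J v) w p + a * c * H (J u) v (J w) p
    + a * d * H (J u) v w (J p) + b * c * H u (J v) (J w) p + b * d * H u (J v) w (J p)
    + c * d * H u v (J w) (J p) + a * b * c * H (J u) (J v) (J w) p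
    + a * b * d * H (J u) (J v) w (J p) + a * c * d * H (J u) v (J w) (J p)
    + b * c * d * H u (J v) (J w) (J p) + a * b * c * d * H (J u) (J v) (J w) (J p)

/-- `∑ₘ t(u,v,m) t(m,w,p)` over the basis `e, Je`. -/
def quadContr (J : V → V) (t : V → V → V → ℝ) (e : Fin 3 → V) (u v w p : V) : ℝ :=
  ∑ k, (t u v (e k) * t (e k) w p + t u v (J (e k)) * t (J (e k)) w p)

/-- With $Z=e-iJe$ one has $e\otimes e+Je\otimes Je=\frac12(Z\otimes\bar Z+\bar Z\otimes Z)$, so the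
real contraction pairs $(1,0)$- with $(0,1)$-components. -/
lemma cplx₄_quadContr (u : V) (a : ℂ) (v : V) (b : ℂ) (w : V) (c : ℂ) (p : V) (d : ℂ) :
    cplx₄ J (quadContr J t e) u a v b w c p d
      = (1 / 2) * ∑ k,
        (cplx₃ J t u a v b (e k) (-Complex.I) * cplx₃ J t (e k) Complex.I w c p d
          + cplx₃ J t u a v b (e k) Complex.I * cplx₃ J t (e k) (-Complex.I) w c p d) := by
  have key : ∀ k, (cplx₃ J t u a v b (e k) (-Complex.I) * cplx₃ J t (e k) Complex.I w c p d
      + cplx₃ J t u a v b (e k) Complex.I * cplx₃ J t (e k) (-Complex.I) w c p d)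
      = 2 * cplx₄ J (fun u v w p ↦ t u v (e k) * t (e k) w p
        + t u v (J (e k)) * t (J (e k)) w p) u a v b w c p d := by
    intro k
    have hI : Complex.I ^ 2 = -1 := Complex.I_sq
    have h1 : ∀ s, cplx₃ J t u a v b (e k) s
        = (t u v (e k) + a * t (J u) v (e k) + b * t u (J v) (e k) + a * b * t (J u) (J v) (e k))
        + s * (t u v (J (e k)) + a * t (J u) v (J (e k)) + b * t u (J v) (J (e k))
          + a * b * t (J u) (J v) (J (e k))) := by
      intro s; simp only [cplx₃]; ring
    have h2 : ∀ s, cplx₃ J t (e k) s w c p d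
        = (t (e k) w p + c * t (e k) (J w) p + d * t (e k) w (J p)
          + c * d * t (e k) (J w) (J p))
        + s * (t (J (e k)) w p + c * t (J (e k)) (J w) p + d * t (J (e k)) w (J p)
          + c * d * t (J (e k)) (J w) (J p)) := by
      intro s; simp only [cplx₃]; ring
    rw [h1, h1, h2, h2]
    simp only [cplx₄, cplx₃]
    push_cast
    generalize (t u v (e k) : ℂ) = x1
    generalize (t (J u) v (e k) : ℂ) = x2
    generalize (t u (J v) (e k) : ℂ) = x3
    generalize (t (J u) (J v) (e k) : ℂ) = x4
    generalize (t u v (J (e k)) : ℂ) = x5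
    generalize (t (J u) v (J (e k)) : ℂ) = x6
    generalize (t u (J v) (J (e k)) : ℂ) = x7
    generalize (t (J u) (J v) (J (e k)) : ℂ) = x8
    generalize (t (e k) w p : ℂ) = y1
    generalize (t (e k) (J w) p : ℂ) = y2
    generalize (t (e k) w (J p) : ℂ) = y3
    generalize (t (e k) (J w) (J p) : ℂ) = y4
    generalize (t (J (e k)) w p : ℂ) = y5
    generalize (t (J (e k)) (J w) p : ℂ) = y6
    generalize (t (J (e k)) w (J p) : ℂ) = y7
    generalize (t (J (e k)) (J w) (J p) : ℂ) = y8
    linear_combination (-2) * (x5 + a * x6 + b * x7 + a * b * x8)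
      * (y5 + c * y6 + d * y7 + c * d * y8) * hI
  rw [Finset.sum_congr rfl fun k _ ↦ key k, ← Finset.mul_sum]
  simp only [quadContr, cplx₄, cplx₃]
  push_cast
  simp only [Finset.mul_sum, ← Finset.sum_add_distrib]
  refine Finset.sum_congr rfl fun k _ ↦ ?_
  ring

/-- Indices 0, 1, 2 stand for $Z_0,Z_1,Z_2$ and 3, 4, 5 for their conjugates. By antisymmetry every
surviving product contains `c 0 1 2`, and the cofactors cancel in pairs. -/
lemma quad_identity_one {c : Fin 6 → Fin 6 → Fin 6 → ℂ} (h₁ : ∀ i j k, c i j k = -c j i k)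
    (h₂ : ∀ i j k, c i j k = -c i k j) :
    c 0 1 0 * c 3 2 2 + c 0 1 3 * c 0 2 2 + (c 0 1 1 * c 4 2 2 + c 0 1 4 * c 1 2 2)
      + (c 0 1 2 * c 5 2 2 + c 0 1 5 * c 2 2 2)
      + (c 1 2 0 * c 3 0 2 + c 1 2 3 * c 0 0 2 + (c 1 2 1 * c 4 0 2 + c 1 2 4 * c 1 0 2)
      + (c 1 2 2 * c 5 0 2 + c 1 2 5 * c 2 0 2))
      + (c 2 0 0 * c 3 1 2 + c 2 0 3 * c 0 1 2 + (c 2 0 1 * c 4 1 2 + c 2 0 4 * c 1 1 2)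
      + (c 2 0 2 * c 5 1 2 + c 2 0 5 * c 2 1 2)) = 0 := by
  have z₁ : ∀ i k, c i i k = 0 := fun i k ↦ by linear_combination h₁ i i k / 2
  have z₂ : ∀ i k, c i k k = 0 := fun i k ↦ by linear_combination h₂ i k k / 2
  -- The order condition turns the antisymmetries into terminating rewrite rules that sort the
  -- indices.
  have s₁ : ∀ i j k, j < i → c i j k = -c j i k := fun i j k _ ↦ h₁ i j k
  have s₂ : ∀ i j k, k < j → c i j k = -c i k j := fun i j k _ ↦ h₂ i j k
  simp (disch := decide) only [z₁, z₂, s₁, s₂]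
  ring

/-- The contraction of the quadratic term in the first Bianchi identity that enters the
`(2,0)`-part of the exterior derivative of the Lee form. -/
lemma quad_identity_two {c : Fin 6 → Fin 6 → Fin 6 → ℂ} (h₁ : ∀ i j k, c i j k = -c j i k)
    (h₂ : ∀ i j k, c i j k = -c i k j) (a b : Fin 3 → Fin 6) (ha : a = ![0, 1, 2])
    (hb : b = ![3, 4, 5]) :
    ∑ d, ∑ k, (c 0 1 (a k) * c (b k) (b d) (a d) + c 0 1 (b k) * c (a k) (b d) (a d)
      + (c 1 (b d) (a k) * c (b k) 0 (a d) + c 1 (b d) (b k) * c (a k) 0 (a d))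
      + (c (b d) 0 (a k) * c (b k) 1 (a d) + c (b d) 0 (b k) * c (a k) 1 (a d)))
    = -∑ d, ∑ k, (c 0 1 (a k) * c (b k) (b d) (a d) - c 0 1 (b k) * c (a k) (b d) (a d)) := by
  have z₁ : ∀ i k, c i i k = 0 := fun i k ↦ by linear_combination h₁ i i k / 2
  have z₂ : ∀ i k, c i k k = 0 := fun i k ↦ by linear_combination h₂ i k k / 2
  have s₁ : ∀ i j k, j < i → c i j k = -c j i k := fun i j k _ ↦ h₁ i j k
  have s₂ : ∀ i j k, k < j → c i j k = -c i k j := fun i j k _ ↦ h₂ i j k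
  subst ha hb
  simp only [Fin.sum_univ_three, Matrix.cons_val_zero, Matrix.cons_val_one, Matrix.cons_val]
  simp (disch := decide) only [z₁, z₂, s₁, s₂]
  ring

end Algebra

end SU3Torsion

end

noncomputable section

namespace SU3Torsion

/-! ### Consequences of the first Bianchi identity at a point -/

section Algebra

variable {V : Type*} [AddCommGroup V]

/-- The `(2,0)`-part of a bilinear form, `β(u - iJu, v - iJv)`. -/
def part₂₀ (J : V → V) (β : V → V → ℝ) (u v : V) : ℂ :=
  ((β u v - β (J u) (J v) : ℝ) : ℂ) - Complex.I * ((β (J u) v + β u (J v) : ℝ) : ℂ)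

/-- The pointwise data of a connection with parallel `SU(3)`-structure and skew torsion: torsion
`t`, its covariant derivative `E`, curvature `r`, linked by the first Bianchi identity.
`e, Je` is an adapted basis. -/
structure BianchiData (J : V → V) (t : V → V → V → ℝ) (E r : V → V → V → V → ℝ)
    (e : Fin 3 → V) : Prop where
  J_sq : ∀ u, J (J u) = -u
  t_swap₁₂ : ∀ u v w, t u v w = -t v u w
  t_swap₂₃ : ∀ u v w, t u v w = -t u w v
  E_neg : ∀ z u v w, E z (-u) v w = -E z u v w
  E_swap₁₂ : ∀ z u v w, E z u v w = -E z v u w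
  E_swap₂₃ : ∀ z u v w, E z u v w = -E z u w v
  r_neg : ∀ u v w p, r u v w (-p) = -r u v w p
  r_skew : ∀ u v w p, r u v w p = -r u v p w
  r_J : ∀ u v w p, r u v w (J p) = r u v p (J w)
  r_trace : ∀ u v, ∑ k, r u v (e k) (J (e k)) = 0
  bianchi : ∀ u v w p, r u v w p + r v w u p + r w u v p
    = E u v w p + E v w u p + E w u v p
      + (quadContr J t e u v w p + quadContr J t e v w u p + quadContr J t e w u v p)

namespace BianchiData

variable {J : V → V} {t : V → V → V → ℝ} {E r : V → V → V → V → ℝ} {e : Fin 3 → V}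

/-- The basis enters the data only through sums over it, so cyclic relabelling is harmless; it
transports index-specific results to the other indices. -/
lemma comp_cycle (h : BianchiData J t E r e) :
    BianchiData J t E r (fun k ↦ e (k + 1)) := by
  have hs : ∀ f : Fin 3 → ℝ, ∑ k, f (k + 1) = ∑ k, f k := fun f ↦
    Equiv.sum_comp (Equiv.addRight (1 : Fin 3)) f
  have hq : ∀ u v w p, quadContr J t (fun k ↦ e (k + 1)) u v w p = quadContr J t e u v w p :=
    fun u v w p ↦ hs fun k ↦ t u v (e k) * t (e k) w p + t u v (J (e k)) * t (J (e k)) w p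
  exact { h with
    r_trace := fun u v ↦ (hs fun k ↦ r u v (e k) (J (e k))).trans (h.r_trace u v)
    bianchi := fun u v w p ↦ by rw [hq, hq, hq]; exact h.bianchi u v w p }

/-- A skew form compatible with `J` has type $(1,1)$, hence vanishes on two $(1,0)$-vectors. -/
lemma cplx₄_r_zero (h : BianchiData J t E r e) (u : V) (a : ℂ) (v : V) (b : ℂ) (w p : V) :
    cplx₄ J r u a v b w (-Complex.I) p (-Complex.I) = 0 := by
  have h₁ : ∀ u v w p, r u v (J w) p = -r u v w (J p) := fun u v w p ↦ by
    rw [h.r_skew, h.r_J]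
  simp only [cplx₄, cplx₃, h₁, h.J_sq, h.r_neg]
  push_cast
  linear_combination (r u v w p + b * r u (J v) w p + a * r (J u) v w p
    + a * b * r (J u) (J v) w p) * Complex.I_sq

/-- Each summand is $-2i$ times the complexified value of `r` on the pair $e_d,Je_d$, so the sum is
a multiple of the trace that vanishes for $\mathfrak{su}(3)$. -/
lemma sum_cplx₄_r (h : BianchiData J t E r e) (u : V) (a : ℂ) (v : V) (b : ℂ) :
    ∑ d, cplx₄ J r u a v b (e d) Complex.I (e d) (-Complex.I) = 0 := by
  have h₁ : ∀ u v w p, r u v (J w) p = -r u v w (J p) := fun u v w p ↦ by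
    rw [h.r_skew, h.r_J]
  have h₀ : ∀ u v w, r u v w w = 0 := fun u v w ↦ by linarith [h.r_skew u v w w]
  have key : ∀ d, cplx₄ J r u a v b (e d) Complex.I (e d) (-Complex.I)
      = -2 * Complex.I * (r u v (e d) (J (e d)) + b * r u (J v) (e d) (J (e d))
        + a * r (J u) v (e d) (J (e d)) + a * b * r (J u) (J v) (e d) (J (e d))) := by
    intro d
    simp only [cplx₄, cplx₃, h₁, h.J_sq, h.r_neg, h₀]
    push_cast
    ring
  have T : ∀ u v, ∑ k, (r u v (e k) (J (e k)) : ℂ) = 0 := fun u v ↦ by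
    exact_mod_cast h.r_trace u v
  simp only [key, ← Finset.mul_sum, Finset.sum_add_distrib, T]
  ring

/-- The vectors `e₁, e₂, e₃, e₁, e₂, e₃`. -/
abbrev frameVec (e : Fin 3 → V) : Fin 6 → V := ![e 0, e 1, e 2, e 0, e 1, e 2]

/-- The coefficients `-i, -i, -i, i, i, i`. -/
abbrev frameCoeff : Fin 6 → ℂ :=
  ![-Complex.I, -Complex.I, -Complex.I, Complex.I, Complex.I, Complex.I]

/-- Components of `t` in the complex frame `e - iJe`, `e + iJe`. -/
def comp (J : V → V) (t : V → V → V → ℝ) (e : Fin 3 → V) (i j k : Fin 6) : ℂ :=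
  cplx₃ J t (frameVec e i) (frameCoeff i) (frameVec e j) (frameCoeff j) (frameVec e k)
    (frameCoeff k)

lemma cplx₃_E_eq (h : BianchiData J t E r e) (z u : V) (a : ℂ) (v : V) (b : ℂ) (w : V) (c : ℂ) :
    cplx₃ J (E z) u a v b w c = -cplx₃ J (E z) v b u a w c ∧
    cplx₃ J (E z) u a v b w c = -cplx₃ J (E z) u a w c v b :=
  ⟨cplx₃_swap₁₂ (h.E_swap₁₂ z) .., cplx₃_swap₂₃ (h.E_swap₂₃ z) ..⟩

lemma cplx₄_E_swap₁₂ (h : BianchiData J t E r e) (z : V) (d : ℂ) (u : V) (a : ℂ) (v : V) (b : ℂ)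
    (w : V) (c : ℂ) : cplx₄ J E z d u a v b w c = -cplx₄ J E z d v b u a w c := by
  rw [cplx₄, (h.cplx₃_E_eq z u a v b w c).1, (h.cplx₃_E_eq (J z) u a v b w c).1, cplx₄]
  ring

lemma cplx₄_E_swap₂₃ (h : BianchiData J t E r e) (z : V) (d : ℂ) (u : V) (a : ℂ) (v : V) (b : ℂ)
    (w : V) (c : ℂ) : cplx₄ J E z d u a v b w c = -cplx₄ J E z d u a w c v b := by
  rw [cplx₄, (h.cplx₃_E_eq z u a v b w c).2, (h.cplx₃_E_eq (J z) u a v b w c).2, cplx₄]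
  ring

/-- The Cauchy-Riemann equation for the coefficient `f` of the `(3,0)`-part of the torsion. -/
lemma cauchyRiemann (h : BianchiData J t E r e) {δ : V → ℂ}
    (hδ : ∀ z, cplx₃ J (E z) (e 0) (-Complex.I) (e 1) (-Complex.I) (e 2) (-Complex.I) = -δ z) :
    δ (e 2) - Complex.I * δ (J (e 2)) = 0 := by
  have B := cplx₄_bianchi (J := J) h.bianchi (e 0) (-Complex.I) (e 1) (-Complex.I) (e 2) (-Complex.I)
    (e 2) (-Complex.I)
  simp only [h.cplx₄_r_zero, cplx₄_quadContr] at B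
  -- Two of the three derivative terms have $Z_2$ twice in antisymmetric slots; only the derivative
  -- of the $(3,0)$-component along $Z_2$ survives.
  have E₁ : cplx₄ J E (e 0) (-Complex.I) (e 1) (-Complex.I) (e 2) (-Complex.I)
      (e 2) (-Complex.I) = 0 := by
    linear_combination h.cplx₄_E_swap₂₃ (e 0) (-Complex.I) (e 1) (-Complex.I) (e 2) (-Complex.I)
      (e 2) (-Complex.I) / 2
  have E₂ : cplx₄ J E (e 1) (-Complex.I) (e 2) (-Complex.I) (e 0) (-Complex.I)
      (e 2) (-Complex.I) = 0 := by
    have e1 := h.cplx₄_E_swap₂₃ (e 1) (-Complex.I) (e 2) (-Complex.I) (e 0) (-Complex.I)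
      (e 2) (-Complex.I)
    have e2 := h.cplx₄_E_swap₁₂ (e 1) (-Complex.I) (e 2) (-Complex.I) (e 2) (-Complex.I)
      (e 0) (-Complex.I)
    linear_combination e1 - e2 / 2
  have E₃ : cplx₄ J E (e 2) (-Complex.I) (e 0) (-Complex.I) (e 1) (-Complex.I)
      (e 2) (-Complex.I) = -(δ (e 2) - Complex.I * δ (J (e 2))) := by
    rw [cplx₄, hδ, hδ]; ring
  have Q := quad_identity_one (c := comp J t e) (fun i j k ↦ cplx₃_swap₁₂ h.t_swap₁₂ ..)
    (fun i j k ↦ cplx₃_swap₂₃ h.t_swap₂₃ ..)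
  simp only [comp, frameVec, frameCoeff, Matrix.cons_val_zero, Matrix.cons_val_one,
    Matrix.cons_val] at Q
  simp only [Fin.sum_univ_three] at B
  linear_combination E₁ + E₂ + E₃ + B + Q / 2

/-- The `(2,0)`-part of the exterior derivative of the Lee form is given by the derivative of the
coefficient of the `(3,0)`-part of the torsion. -/
lemma part₂₀_eq (h : BianchiData J t E r e) {δ : V → ℂ}
    (hδ : ∀ z, cplx₃ J (E z) (e 0) (-Complex.I) (e 1) (-Complex.I) (e 2) (-Complex.I) = -δ z)
    {β : V → V → ℝ}
    (hβ : ∀ u v, β u v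
      = -∑ k, (E u (J v) (e k) (J (e k)) - E v (J u) (e k) (J (e k)))
        - ∑ k, ∑ a, (t u v (e a) * t (J (e a)) (e k) (J (e k))
          - t u v (J (e a)) * t (e a) (e k) (J (e k)))) :
    part₂₀ J β (e 0) (e 1) = δ (e 2) := by
  have CR := h.cauchyRiemann hδ
  have E₀ : ∀ z u v, E z u v v = 0 := fun z u v ↦ by linarith [h.E_swap₂₃ z u v v]
  have t₀ : ∀ u v, t u v v = 0 := fun u v ↦ by linarith [h.t_swap₂₃ u v v]
  -- The derivative terms of $\beta(Z_0,Z_1)$ are half of the first two derivative terms in the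
  -- Bianchi identity at $(Z_0,Z_1,\bar Z_k;Z_k)$.
  have EP : ∀ k, part₂₀ J (fun u v ↦ -(E u (J v) (e k) (J (e k)) - E v (J u) (e k) (J (e k))))
      (e 0) (e 1) = (cplx₄ J E (e 0) (-Complex.I) (e 1) (-Complex.I) (e k) Complex.I
        (e k) (-Complex.I) + cplx₄ J E (e 1) (-Complex.I) (e k) Complex.I (e 0) (-Complex.I)
        (e k) (-Complex.I)) / 2 := by
    intro k
    rw [h.cplx₄_E_swap₁₂ (e 1) _ (e k)]
    simp only [part₂₀, cplx₄, cplx₃, h.J_sq, h.E_neg, E₀,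
      h.E_swap₂₃ _ _ (J (e k)) (e k)]
    push_cast
    ring_nf
    simp only [Complex.I_sq, Complex.I_pow_three]
    ring
  have TP : ∀ k a, part₂₀ J (fun u v ↦ -(t u v (e a) * t (J (e a)) (e k) (J (e k))
      - t u v (J (e a)) * t (e a) (e k) (J (e k)))) (e 0) (e 1)
      = -(cplx₃ J t (e 0) (-Complex.I) (e 1) (-Complex.I) (e a) (-Complex.I)
          * cplx₃ J t (e a) Complex.I (e k) Complex.I (e k) (-Complex.I)
        - cplx₃ J t (e 0) (-Complex.I) (e 1) (-Complex.I) (e a) Complex.I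
          * cplx₃ J t (e a) (-Complex.I) (e k) Complex.I (e k) (-Complex.I)) / 4 := by
    intro k a
    simp only [part₂₀, cplx₃, t₀, h.t_swap₂₃ _ (J (e k)) (e k)]
    push_cast
    ring_nf
    simp only [Complex.I_sq, Complex.I_pow_three, Complex.I_pow_four]
    ring
  have hβ₂₀ : part₂₀ J β (e 0) (e 1)
      = ∑ k, part₂₀ J (fun u v ↦ -(E u (J v) (e k) (J (e k)) - E v (J u) (e k) (J (e k))))
          (e 0) (e 1)
        + ∑ k, ∑ a, part₂₀ J (fun u v ↦ -(t u v (e a) * t (J (e a)) (e k) (J (e k))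
          - t u v (J (e a)) * t (e a) (e k) (J (e k)))) (e 0) (e 1) := by
    simp only [part₂₀, hβ, Fin.sum_univ_three]
    push_cast
    ring
  simp only [EP, TP, Fin.sum_univ_three] at hβ₂₀
  -- The remaining derivative terms, along $\bar Z_d$, vanish for $d=0,1$ by repetition. For $d=2$
  -- the term is $-(\delta(e_2)+i\delta(Je_2))$, which `CR` makes equal to $-2\delta(e_2)$.
  have E₁ : ∀ k l, cplx₄ J E (e k) Complex.I (e l) (-Complex.I) (e 1) (-Complex.I)
      (e l) (-Complex.I) = 0 := by
    intro k l
    have e1 := h.cplx₄_E_swap₂₃ (e k) Complex.I (e l) (-Complex.I) (e 1) (-Complex.I)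
      (e l) (-Complex.I)
    have e2 := h.cplx₄_E_swap₁₂ (e k) Complex.I (e l) (-Complex.I) (e l) (-Complex.I)
      (e 1) (-Complex.I)
    linear_combination e1 - e2 / 2
  have E₂ : cplx₄ J E (e 1) Complex.I (e 0) (-Complex.I) (e 1) (-Complex.I)
      (e 1) (-Complex.I) = 0 := by
    linear_combination h.cplx₄_E_swap₂₃ (e 1) Complex.I (e 0) (-Complex.I) (e 1) (-Complex.I)
      (e 1) (-Complex.I) / 2
  have E₃ : cplx₄ J E (e 2) Complex.I (e 0) (-Complex.I) (e 1) (-Complex.I)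
      (e 2) (-Complex.I) = -(δ (e 2) + Complex.I * δ (J (e 2))) := by
    rw [cplx₄, hδ, hδ]; ring
  have E₁' := E₁ 0 0
  have B := fun d ↦ cplx₄_bianchi (J := J) h.bianchi (e 0) (-Complex.I) (e 1) (-Complex.I)
    (e d) Complex.I (e d) (-Complex.I)
  simp only [h.cplx₄_r_zero, add_zero, cplx₄_quadContr, Fin.sum_univ_three] at B
  have R := h.sum_cplx₄_r (e 0) (-Complex.I) (e 1) (-Complex.I)
  have Q := quad_identity_two (c := comp J t e) (fun i j k ↦ cplx₃_swap₁₂ h.t_swap₁₂ ..)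
    (fun i j k ↦ cplx₃_swap₂₃ h.t_swap₂₃ ..) _ _ rfl rfl
  simp only [comp, frameVec, frameCoeff, Matrix.cons_val_zero, Matrix.cons_val_one,
    Matrix.cons_val, Fin.sum_univ_three] at Q
  simp only [Fin.sum_univ_three] at R
  rw [hβ₂₀]
  linear_combination (1 / 2) * R - (B 0 + B 1 + B 2) / 2 - E₁' / 2 - E₂ / 2 - E₃ / 2
    - Q / 4 - CR / 2

/-- A cyclic permutation of three vectors is even, so it preserves the $(3,0)$-component; it also
preserves the sums defining `β`. One index computation therefore covers all three. -/
lemma cauchyRiemann_part₂₀ (h : BianchiData J t E r e) {δ : V → ℂ}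
    (hδ : ∀ z, cplx₃ J (E z) (e 0) (-Complex.I) (e 1) (-Complex.I) (e 2) (-Complex.I) = -δ z)
    {β : V → V → ℝ}
    (hβ : ∀ u v, β u v
      = -∑ k, (E u (J v) (e k) (J (e k)) - E v (J u) (e k) (J (e k)))
        - ∑ k, ∑ a, (t u v (e a) * t (J (e a)) (e k) (J (e k))
          - t u v (J (e a)) * t (e a) (e k) (J (e k)))) (k : Fin 3) :
    δ (e (k + 2)) - Complex.I * δ (J (e (k + 2))) = 0 ∧
      part₂₀ J β (e k) (e (k + 1)) = δ (e (k + 2)) := by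
  have step : ∀ e' : Fin 3 → V,
      (∀ z, cplx₃ J (E z) (e' 0) (-Complex.I) (e' 1) (-Complex.I) (e' 2) (-Complex.I) = -δ z) →
      ∀ z, cplx₃ J (E z) (e' 1) (-Complex.I) (e' 2) (-Complex.I) (e' 0) (-Complex.I) = -δ z := by
    intro e' he' z
    rw [(h.cplx₃_E_eq z _ _ _ _ _ _).2, (h.cplx₃_E_eq z _ _ _ _ _ _).1, he', neg_neg]
  have hs : ∀ f : Fin 3 → ℝ, ∑ k, f (k + 1) = ∑ k, f k := fun f ↦
    Equiv.sum_comp (Equiv.addRight (1 : Fin 3)) f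
  have stepβ : ∀ e' : Fin 3 → V, (∀ u v, β u v
      = -∑ k, (E u (J v) (e' k) (J (e' k)) - E v (J u) (e' k) (J (e' k)))
        - ∑ k, ∑ a, (t u v (e' a) * t (J (e' a)) (e' k) (J (e' k))
          - t u v (J (e' a)) * t (e' a) (e' k) (J (e' k)))) → ∀ u v, β u v
      = -∑ k, (E u (J v) (e' (k + 1)) (J (e' (k + 1))) - E v (J u) (e' (k + 1)) (J (e' (k + 1))))
        - ∑ k, ∑ a, (t u v (e' (a + 1)) * t (J (e' (a + 1))) (e' (k + 1)) (J (e' (k + 1)))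
          - t u v (J (e' (a + 1))) * t (e' (a + 1)) (e' (k + 1)) (J (e' (k + 1)))) := by
    intro e' he' u v
    rw [he' u v, hs fun k ↦ E u (J v) (e' k) (J (e' k)) - E v (J u) (e' k) (J (e' k)),
      ← hs fun k ↦ ∑ a, (t u v (e' a) * t (J (e' a)) (e' k) (J (e' k))
          - t u v (J (e' a)) * t (e' a) (e' k) (J (e' k)))]
    congr 1
    refine Finset.sum_congr rfl fun k _ ↦ ?_
    exact (hs fun a ↦ t u v (e' a) * t (J (e' a)) (e' (k + 1)) (J (e' (k + 1)))
      - t u v (J (e' a)) * t (e' a) (e' (k + 1)) (J (e' (k + 1)))).symm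
  have h₁ := h.comp_cycle
  have hδ₁ := step e hδ
  have hβ₁ := stepβ e hβ
  have h₂ := h₁.comp_cycle
  have hδ₂ := step (fun k ↦ e (k + 1)) hδ₁
  have hβ₂ := stepβ (fun k ↦ e (k + 1)) hβ₁
  fin_cases k
  · exact ⟨h.cauchyRiemann hδ, h.part₂₀_eq hδ hβ⟩
  · exact ⟨h₁.cauchyRiemann hδ₁, h₁.part₂₀_eq hδ₁ hβ₁⟩
  · exact ⟨h₂.cauchyRiemann hδ₂, h₂.part₂₀_eq hδ₂ hβ₂⟩

end BianchiData

end Algebra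

end SU3Torsion

end

noncomputable section

namespace SU3Torsion

/-! ### Complex coordinates and the volume form of an adapted basis -/

section AdaptedBasis

variable {V : Type*} [NormedAddCommGroup V] [InnerProductSpace ℝ V] {J : V →L[ℝ] V}
  (e : OrthonormalBasis (Fin 3 × Fin 2) ℝ V)

/-- The complex coordinates `e₂ₖ₋₁ + i e₂ₖ` of a vector. -/
def cplxCoord (k : Fin 3) (u : V) : ℂ :=
  ((⟪e (k, 0), u⟫_ℝ : ℝ) : ℂ) + Complex.I * ((⟪e (k, 1), u⟫_ℝ : ℝ) : ℂ)

variable {e}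

lemma eq_sum_adapted (he : ∀ j, J (e (j, 0)) = e (j, 1)) (u : V) :
    u = ∑ k, (⟪e (k, 0), u⟫_ℝ • e (k, 0) + ⟪e (k, 1), u⟫_ℝ • J (e (k, 0))) := by
  conv_lhs => rw [← e.sum_repr' u, Fintype.sum_prod_type]
  simp [Fin.sum_univ_two, he]

lemma sum_adapted {F : V → ℝ} (he : ∀ j, J (e (j, 0)) = e (j, 1)) :
    ∑ i, F (e i) = ∑ k, (F (e (k, 0)) + F (J (e (k, 0)))) := by
  rw [Fintype.sum_prod_type]
  simp [Fin.sum_univ_two, he]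

/-- The condition on `J` makes `φ` complex linear, so three values determine it. -/
lemma eq_sum_cplxCoord (he : ∀ j, J (e (j, 0)) = e (j, 1)) {φ : V → ℂ}
    (hadd : ∀ u v, φ (u + v) = φ u + φ v) (hsmul : ∀ (r : ℝ) u, φ (r • u) = r * φ u)
    (hJ : ∀ u, φ (J u) = Complex.I * φ u) (u : V) :
    φ u = ∑ k, cplxCoord e k u * φ (e (k, 0)) := by
  conv_lhs => rw [eq_sum_adapted he u]
  simp only [Fin.sum_univ_three, hadd, hsmul, hJ, cplxCoord]
  ring

/-- A complex-valued bilinear form, complex linear in each variable, vanishes if it is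
antisymmetric and vanishes on an adapted basis. -/
lemma part₂₀_eq_zero (he : ∀ j, J (e (j, 0)) = e (j, 1)) (hJ : ∀ u, J (J u) = -u)
    {β : V → V → ℝ} (hadd : ∀ u v w, β (u + v) w = β u w + β v w)
    (hsmul : ∀ (r : ℝ) u w, β (r • u) w = r * β u w) (hanti : ∀ u v, β u v = -β v u)
    (h : ∀ k, part₂₀ J β (e (k, 0)) (e (k + 1, 0)) = 0) (u v : V) : part₂₀ J β u v = 0 := by
  have hneg : ∀ u w, β (-u) w = -β u w := fun u w ↦ by
    have := hsmul (-1) u w; simpa using this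
  have anti : ∀ u v, part₂₀ J β u v = -part₂₀ J β v u := fun u v ↦ by
    simp only [part₂₀]
    rw [hanti u v, hanti (J u) (J v), hanti (J u) v, hanti u (J v)]
    push_cast
    ring
  have expand : ∀ u v, part₂₀ J β u v
      = ∑ k, cplxCoord e k u * part₂₀ J β (e (k, 0)) v := fun u v ↦ by
    refine eq_sum_cplxCoord he (φ := fun u ↦ part₂₀ J β u v) ?_ ?_ ?_ u
    · intro u u'
      simp only [part₂₀, map_add, hadd]
      push_cast
      ring
    · intro r u
      simp only [part₂₀, map_smul, hsmul]
      push_cast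
      ring
    · intro u
      simp only [part₂₀, hJ, hneg]
      push_cast
      linear_combination (β (J u) v + β u (J v) : ℂ) * Complex.I_sq
  have hb : ∀ k l, part₂₀ J β (e (k, 0)) (e (l, 0)) = 0 := by
    have h0 := h 0
    have h1 := h 1
    have h2 := h 2
    have hd : ∀ u, part₂₀ J β u u = 0 := fun u ↦ by linear_combination anti u u / 2
    intro k l
    fin_cases k <;> fin_cases l
    · exact hd _
    · exact h0
    · rw [anti]; exact neg_eq_zero.mpr h2
    · rw [anti]; exact neg_eq_zero.mpr h0
    · exact hd _
    · exact h1
    · exact h2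
    · rw [anti]; exact neg_eq_zero.mpr h1
    · exact hd _
  have hb' : ∀ k v, part₂₀ J β (e (k, 0)) v = 0 := fun k v ↦ by
    rw [anti, expand]
    simp [hb]
  rw [expand]
  simp [hb']

/-- The complex volume form `-det(cplxCoord)` of an adapted basis. -/
def cplxVolume (e : OrthonormalBasis (Fin 3 × Fin 2) ℝ V) (v : Fin 3 → V) : ℂ :=
  -Matrix.det (Matrix.of fun j k : Fin 3 ↦ cplxCoord e j (v k))

lemma cplxCoord_basis (j k : Fin 3) :
    cplxCoord e j (e (k, 0)) = if j = k then 1 else 0 := by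
  have := e.orthonormal
  rw [orthonormal_iff_ite] at this
  by_cases h : j = k <;> simp [cplxCoord, this, h]

lemma cplxVolume_basis :
    cplxVolume e ![e (0, 0), e (1, 0), e (2, 0)] = -1 := by
  simp [cplxVolume, Matrix.det_fin_three, cplxCoord_basis]

/-- The `(3,0)`-part of a 3-form is a multiple of the complex volume form. -/
lemma cplx₃_eq_cplxVolume (he : ∀ j, J (e (j, 0)) = e (j, 1)) (hJ : ∀ u, J (J u) = -u)
    {T : V →L[ℝ] V →L[ℝ] V} (h₁ : ∀ u v w, ⟪T u v, w⟫_ℝ = -⟪T v u, w⟫_ℝ)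
    (h₂ : ∀ u v w, ⟪T u v, w⟫_ℝ = -⟪T u w, v⟫_ℝ) (u v w : V) :
    cplx₃ J (fun u v w ↦ ⟪T u v, w⟫_ℝ) u (-Complex.I) v (-Complex.I) w (-Complex.I)
      = -cplx₃ J (fun u v w ↦ ⟪T u v, w⟫_ℝ) (e (0, 0)) (-Complex.I) (e (1, 0)) (-Complex.I)
        (e (2, 0)) (-Complex.I) * cplxVolume e ![u, v, w] := by
  set τ : V → V → V → ℂ := fun u v w ↦
    cplx₃ J (fun u v w ↦ ⟪T u v, w⟫_ℝ) u (-Complex.I) v (-Complex.I) w (-Complex.I) with hτ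
  have a₁ : ∀ u v w, τ u v w = -τ v u w := fun u v w ↦ cplx₃_swap₁₂ h₁ ..
  have a₂ : ∀ u v w, τ u v w = -τ u w v := fun u v w ↦ cplx₃_swap₂₃ h₂ ..
  have z₁ : ∀ u w, τ u u w = 0 := fun u w ↦ by linear_combination a₁ u u w / 2
  have z₂ : ∀ u w, τ u w w = 0 := fun u w ↦ by linear_combination a₂ u w w / 2
  have z₃ : ∀ u w, τ u w u = 0 := fun u w ↦ by rw [a₂, z₁, neg_zero]
  have expand : ∀ u v w, τ u v w = ∑ k, cplxCoord e k u * τ (e (k, 0)) v w := by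
    intro u v w
    refine eq_sum_cplxCoord he (φ := fun u ↦ τ u v w) ?_ ?_ ?_ u
    · intro u u'
      simp only [hτ, cplx₃, map_add, add_apply, inner_add_left]
      push_cast
      ring
    · intro r u
      simp only [hτ, cplx₃, map_smul, smul_apply, inner_smul_left]
      push_cast
      simp only [conj_trivial]
      ring
    · intro u
      simp only [hτ, cplx₃, hJ, map_neg, neg_apply, inner_neg_left]
      push_cast
      generalize (⟪T u v, w⟫_ℝ : ℂ) = x1
      generalize (⟪T (J u) v, w⟫_ℝ : ℂ) = x2
      generalize (⟪T u (J v), w⟫_ℝ : ℂ) = x3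
      generalize (⟪T (J u) (J v), w⟫_ℝ : ℂ) = x4
      generalize (⟪T u v, J w⟫_ℝ : ℂ) = x5
      generalize (⟪T (J u) v, J w⟫_ℝ : ℂ) = x6
      generalize (⟪T u (J v), J w⟫_ℝ : ℂ) = x7
      generalize (⟪T (J u) (J v), J w⟫_ℝ : ℂ) = x8
      ring_nf
      simp only [Complex.I_sq, Complex.I_pow_three, Complex.I_pow_four]
      ring
  have expand₂ : ∀ u v w, τ u v w = ∑ k, cplxCoord e k v * τ u (e (k, 0)) w := by
    intro u v w
    rw [a₁, expand, ← Finset.sum_neg_distrib]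
    refine Finset.sum_congr rfl fun k _ ↦ ?_
    rw [a₁]; ring
  have expand₃ : ∀ u v w, τ u v w = ∑ k, cplxCoord e k w * τ u v (e (k, 0)) := by
    intro u v w
    rw [a₂, expand₂, ← Finset.sum_neg_distrib]
    refine Finset.sum_congr rfl fun k _ ↦ ?_
    rw [a₂]; ring
  have p₁ : τ (e (1, 0)) (e (0, 0)) (e (2, 0)) = -τ (e (0, 0)) (e (1, 0)) (e (2, 0)) := a₁ ..
  have p₂ : τ (e (0, 0)) (e (2, 0)) (e (1, 0)) = -τ (e (0, 0)) (e (1, 0)) (e (2, 0)) := a₂ ..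
  have p₃ : τ (e (1, 0)) (e (2, 0)) (e (0, 0)) = τ (e (0, 0)) (e (1, 0)) (e (2, 0)) := by
    rw [a₂, p₁, neg_neg]
  have p₄ : τ (e (2, 0)) (e (0, 0)) (e (1, 0)) = τ (e (0, 0)) (e (1, 0)) (e (2, 0)) := by
    rw [a₁, p₂, neg_neg]
  have p₅ : τ (e (2, 0)) (e (1, 0)) (e (0, 0)) = -τ (e (0, 0)) (e (1, 0)) (e (2, 0)) := by
    rw [a₁, p₃]
  change τ u v w = -τ (e (0, 0)) (e (1, 0)) (e (2, 0)) * _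
  -- Once all three slots are expanded, only permutations of the three basis vectors contribute,
  -- with the signs of the determinant.
  rw [expand]
  simp only [Fin.sum_univ_three, expand₂ _ v w, expand₃ _ _ w, z₁, z₂, z₃, p₁, p₂, p₃, p₄, p₅]
  simp only [cplxVolume, Matrix.det_fin_three, Matrix.of_apply, Matrix.cons_val_zero,
    Matrix.cons_val_one, Matrix.cons_val]
  ring

end AdaptedBasis

/-! ### Basis independence of the tensor norm -/

section HilbertSchmidt

variable {V : Type*} [NormedAddCommGroup V] [InnerProductSpace ℝ V]
  {ι ι' : Type*} [Fintype ι] [Fintype ι'] (b : OrthonormalBasis ι ℝ V)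
  (e : OrthonormalBasis ι' ℝ V)

/-- Both sides are $\sum_{i,j}\langle e_j,Ab_i\rangle^2$. -/
lemma sum_norm_sq_map_basis_eq_adjoint [CompleteSpace V] (A : V →L[ℝ] V) :
    ∑ i, ‖A (b i)‖ ^ 2 = ∑ j, ‖ContinuousLinearMap.adjoint A (e j)‖ ^ 2 := by
  have h : ∀ j, ‖ContinuousLinearMap.adjoint A (e j)‖ ^ 2 = ∑ i, ⟪e j, A (b i)⟫_ℝ ^ 2 := by
    intro j
    rw [← b.sum_sq_norm_inner_right (ContinuousLinearMap.adjoint A (e j))]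
    refine Finset.sum_congr rfl fun i _ ↦ ?_
    rw [ContinuousLinearMap.adjoint_inner_right, real_inner_comm, Real.norm_eq_abs, sq_abs]
  simp only [h, ← e.sum_sq_norm_inner_right (A (b _)), Real.norm_eq_abs, sq_abs]
  exact Finset.sum_comm

lemma sum_norm_sq_map_basis_eq (A : V →L[ℝ] V) :
    ∑ i, ‖A (b i)‖ ^ 2 = ∑ i, ‖A (e i)‖ ^ 2 := by
  have : FiniteDimensional ℝ V := b.toBasis.finiteDimensional_of_finite
  have : CompleteSpace V := FiniteDimensional.complete ℝ V
  rw [sum_norm_sq_map_basis_eq_adjoint b e, sum_norm_sq_map_basis_eq_adjoint e e,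
    ContinuousLinearMap.adjoint_adjoint]

/-- The norm of $N$ uses the arbitrary basis `onb`, its computation an adapted one. The last slot is
summed into a norm and the other two are changed one at a time. -/
lemma sum_sq_trilinear_basis_eq (A : V →L[ℝ] V →L[ℝ] V) :
    ∑ i, ∑ j, ∑ k, ⟪A (b i) (b j), b k⟫_ℝ ^ 2 = ∑ i, ∑ j, ∑ k, ⟪A (e i) (e j), e k⟫_ℝ ^ 2 := by
  have h₁ : ∀ u v, ∑ k, ⟪A u v, b k⟫_ℝ ^ 2 = ‖A u v‖ ^ 2 := fun u v ↦ by
    rw [← b.sum_sq_norm_inner_left (A u v)]; simp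
  have h₂ : ∀ u v, ∑ k, ⟪A u v, e k⟫_ℝ ^ 2 = ‖A u v‖ ^ 2 := fun u v ↦ by
    rw [← e.sum_sq_norm_inner_left (A u v)]; simp
  simp only [h₁, h₂]
  calc _ = ∑ i, ∑ j, ‖A (b i) (e j)‖ ^ 2 :=
        Finset.sum_congr rfl fun i _ ↦ sum_norm_sq_map_basis_eq b e (A (b i))
    _ = ∑ j, ∑ i, ‖A.flip (e j) (b i)‖ ^ 2 := Finset.sum_comm
    _ = ∑ j, ∑ i, ‖A.flip (e j) (e i)‖ ^ 2 :=
        Finset.sum_congr rfl fun j _ ↦ sum_norm_sq_map_basis_eq b e (A.flip (e j))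
    _ = _ := Finset.sum_comm

/-- The squared norm of the real part of `f` times the complex volume form. -/
lemma sum_sq_re_mul_cplxVolume (e : OrthonormalBasis (Fin 3 × Fin 2) ℝ V) (f : ℂ) :
    ∑ i, ∑ j, ∑ k, (f * cplxVolume e ![e i, e j, e k]).re ^ 2 = 24 * Complex.normSq f := by
  let ε (j k : Fin 3) : ℝ := if j = k then 1 else 0
  let g (a b c : Fin 3) : ℝ := Matrix.det (Matrix.of fun j k ↦ ε j ((![a, b, c] : Fin 3 → _) k))
  have coord : ∀ j k (s : Fin 2), cplxCoord e j (e (k, s))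
      = (if s = 0 then 1 else Complex.I) * (ε j k : ℂ) := by
    have := e.orthonormal
    rw [orthonormal_iff_ite] at this
    intro j k s
    by_cases h : j = k <;> fin_cases s <;> simp [cplxCoord, this, h, ε]
  have vol : ∀ (a b c : Fin 3) (s s' s'' : Fin 2),
      cplxVolume e ![e (a, s), e (b, s'), e (c, s'')] = -((if s = 0 then 1 else Complex.I)
        * (if s' = 0 then 1 else Complex.I) * (if s'' = 0 then 1 else Complex.I) * g a b c) := by
    intro a b c s s' s''
    simp only [cplxVolume, g, Matrix.det_fin_three, Matrix.of_apply, Matrix.cons_val_zero,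
      Matrix.cons_val_one, Matrix.cons_val, coord]
    push_cast
    ring
  -- Of the eight choices, four give a factor $\pm1$ and four $\pm i$, hence
  -- $4(\mathrm{Re}f)^2+4(\mathrm{Im}f)^2$. The six permutations in `hg` then produce 24.
  have key : ∀ a b c : Fin 3, ∑ s, ∑ s', ∑ s'',
      (f * cplxVolume e ![e (a, s), e (b, s'), e (c, s'')]).re ^ 2
        = 4 * Complex.normSq f * g a b c ^ 2 := by
    intro a b c
    simp only [vol, Fin.sum_univ_two, Complex.normSq_apply]
    simp
    ring
  have hg : ∑ a, ∑ b, ∑ c, g a b c ^ 2 = 6 := by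
    simp only [g, Matrix.det_fin_three, Matrix.of_apply, Matrix.cons_val_zero,
      Matrix.cons_val_one, Matrix.cons_val, Fin.sum_univ_three]
    simp [ε]
    norm_num
  calc _ = ∑ a, ∑ b, ∑ c, ∑ s, ∑ s', ∑ s'',
        (f * cplxVolume e ![e (a, s), e (b, s'), e (c, s'')]).re ^ 2 := by
        simp only [Fintype.sum_prod_type]
        refine Finset.sum_congr rfl fun a _ ↦ ?_
        rw [Finset.sum_comm]
        refine Finset.sum_congr rfl fun b _ ↦ ?_
        simp only [Finset.sum_comm (s := Finset.univ (α := Fin 2)) (t := Finset.univ (α := Fin 3))]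
    _ = _ := by
        simp only [key, ← Finset.mul_sum, hg]
        ring

end HilbertSchmidt

end SU3Torsion

end

noncomputable section

namespace SU3Torsion

/-! ### Coordinate vector fields -/

section VectorFields

variable {M : Type*} [TopologicalSpace M] [ChartedSpace (EuclideanSpace ℝ (Fin 6)) M]
  [IsManifold (𝓡 6) ∞ M]

/-- The trivialization of the tangent bundle at `x`, restricted to the tangent space at `x`. -/
def coordAt (x : M) : Tan x →L[ℝ] EuclideanSpace ℝ (Fin 6) :=
  (trivializationAt (EuclideanSpace ℝ (Fin 6)) (TangentSpace (𝓡 6)) x).continuousLinearMapAt ℝ x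

lemma ext_eq_symmL {x : M} (v : Tan x) {y : M}
    (hy : y ∈ (chartAt (EuclideanSpace ℝ (Fin 6)) x).source) :
    ext v y = (trivializationAt (EuclideanSpace ℝ (Fin 6)) (TangentSpace (𝓡 6)) x).symmL ℝ y
      (coordAt x v) := by
  have h : coordAt x v
      = (trivializationAt (EuclideanSpace ℝ (Fin 6)) (TangentSpace (𝓡 6)) x ⟨x, v⟩).2 :=
    Bundle.Trivialization.continuousLinearMapAt_apply_of_mem ℝ _
      (FiberBundle.mem_baseSet_trivializationAt' x) _
  have hm : y ∈ (trivializationAt (EuclideanSpace ℝ (Fin 6)) (TangentSpace (𝓡 6)) x).baseSet := hy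
  rw [h, Bundle.Trivialization.symmL_apply _ hm]
  rfl

@[simp] lemma ext_self {x : M} (v : Tan x) : ext v x = v :=
  FiberBundle.extend_apply_self _ v

omit [IsManifold (𝓡 6) ∞ M] in
lemma chart_source_mem_nhds (x : M) :
    ∀ᶠ y in nhds x, y ∈ (chartAt (EuclideanSpace ℝ (Fin 6)) x).source :=
  (chartAt _ x).open_source.mem_nhds (mem_chart_source _ x)

lemma SmoothAt.diffAt {X : Π y : M, Tan y} {x : M} (h : SmoothAt X x) : DiffAt X x :=
  ContMDiffAt.mdifferentiableAt h (by simp)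

lemma smoothAt_ext {x : M} (v : Tan x) {y : M}
    (hy : y ∈ (chartAt (EuclideanSpace ℝ (Fin 6)) x).source) : SmoothAt (ext v) y := by
  have hm : y ∈ (trivializationAt (EuclideanSpace ℝ (Fin 6)) (TangentSpace (𝓡 6)) x).baseSet := hy
  rw [SmoothAt, Bundle.Trivialization.contMDiffAt_section_iff _ hm]
  refine (contMDiffAt_const (c := coordAt x v)).congr_of_eventuallyEq ?_
  filter_upwards [(trivializationAt _ _ x).open_baseSet.mem_nhds hm] with z hz
  rw [ext_eq_symmL _ hz, ← Bundle.Trivialization.continuousLinearMapAt_apply_of_mem ℝ _ hz]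
  exact Bundle.Trivialization.continuousLinearMapAt_symmL _ hz _

lemma diffAt_ext {x : M} (v : Tan x) : DiffAt (ext v) x :=
  (smoothAt_ext v (mem_chart_source _ x)).diffAt

/-- In the chart at `x` the field `ext v` is constant, so derivatives along such fields reduce to
ordinary partial derivatives. -/
lemma mvfderiv_extChartAt_ext {x : M} (v : Tan x) {y : M}
    (hy : y ∈ (chartAt (EuclideanSpace ℝ (Fin 6)) x).source) :
    mvfderiv (𝓡 6) (extChartAt (𝓡 6) x) y (ext v y) = coordAt x v := by
  have H := TangentBundle.continuousLinearMapAt_trivializationAt (𝕜 := ℝ) (I := 𝓡 6)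
    (E := EuclideanSpace ℝ (Fin 6)) hy
  have H' := (Bundle.Trivialization.continuousLinearMapAt_symmL (R := ℝ)
    (trivializationAt (EuclideanSpace ℝ (Fin 6)) (TangentSpace (𝓡 6)) x) hy (coordAt x v))
  rw [← ext_eq_symmL _ hy] at H'
  rw [← H', H]
  rfl

variable {V : Type*} [NormedAddCommGroup V] [NormedSpace ℝ V]

omit [IsManifold (𝓡 6) ∞ M] in
lemma dirDeriv_congr {h h' : M → V} {x : M} (e : h =ᶠ[nhds x] h') :
    dirDeriv h x = dirDeriv h' x := by
  funext v
  unfold dirDeriv mvfderiv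
  simp only [ContinuousLinearMap.comp_apply]
  rw [e.mfderiv_eq]
  rfl

lemma dirDeriv_comp_extChartAt {x : M} (v : Tan x) {y : M}
    (hy : y ∈ (chartAt (EuclideanSpace ℝ (Fin 6)) x).source)
    {F : EuclideanSpace ℝ (Fin 6) → V} (hF : DifferentiableAt ℝ F (extChartAt (𝓡 6) x y)) :
    dirDeriv (F ∘ extChartAt (𝓡 6) x) y (ext v y)
      = fderiv ℝ F (extChartAt (𝓡 6) x y) (coordAt x v) := by
  have hφ : MDifferentiableAt (𝓡 6) 𝓘(ℝ, EuclideanSpace ℝ (Fin 6)) (extChartAt (𝓡 6) x) y :=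
    mdifferentiableAt_extChartAt hy
  have hF' : MDifferentiableAt 𝓘(ℝ, EuclideanSpace ℝ (Fin 6)) 𝓘(ℝ, V) F
    (extChartAt (𝓡 6) x y) := hF.mdifferentiableAt
  refine (mfderiv_comp_apply y hF' hφ (ext v y)).trans ?_
  rw [← mvfderiv_extChartAt_ext v hy, ← mfderiv_eq_fderiv]
  rfl

omit [IsManifold (𝓡 6) ∞ M] in
lemma eventuallyEq_comp_extChartAt {W : Type*} (h : M → W) {x y : M}
    (hy : y ∈ (chartAt (EuclideanSpace ℝ (Fin 6)) x).source) :
    h =ᶠ[nhds y] (h ∘ (extChartAt (𝓡 6) x).symm) ∘ extChartAt (𝓡 6) x := by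
  have hy' : y ∈ (extChartAt (𝓡 6) x).source := by rwa [extChartAt_source]
  filter_upwards [(isOpen_extChartAt_source (I := 𝓡 6) x).mem_nhds hy'] with z hz
  rw [Function.comp_apply, Function.comp_apply, (extChartAt (𝓡 6) x).left_inv hz]

lemma contDiffAt_comp_extChartAt_symm {n : ℕ∞} {x y : M}
    (hy : y ∈ (chartAt (EuclideanSpace ℝ (Fin 6)) x).source) {h : M → V}
    (hh : ContMDiffAt (𝓡 6) 𝓘(ℝ, V) n h y) :
    ContDiffAt ℝ n (h ∘ (extChartAt (𝓡 6) x).symm) (extChartAt (𝓡 6) x y) := by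
  have hy' : y ∈ (extChartAt (𝓡 6) x).source := by rwa [extChartAt_source]
  have hleft : (extChartAt (𝓡 6) x).symm (extChartAt (𝓡 6) x y) = y :=
    (extChartAt (𝓡 6) x).left_inv hy'
  have : IsManifold (𝓡 6) n M := IsManifold.of_le (n := ∞) (by exact_mod_cast le_top)
  have hψ : ContMDiffAt 𝓘(ℝ, EuclideanSpace ℝ (Fin 6)) (𝓡 6) n (extChartAt (𝓡 6) x).symm
      (extChartAt (𝓡 6) x y) :=
    (contMDiffOn_extChartAt_symm x).contMDiffAt
      (extChartAt_target_mem_nhds' ((extChartAt (𝓡 6) x).map_source hy'))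
  exact (ContMDiffAt.comp _ (by rwa [hleft]) hψ).contDiffAt

/-- Second derivatives along coordinate fields commute. -/
lemma dirDeriv_symm {x : M} (u v : Tan x) {h : M → V}
    (hh : ContMDiffAt (𝓡 6) 𝓘(ℝ, V) ∞ h x) :
    dirDeriv (fun y ↦ dirDeriv h y (ext v y)) x u
      = dirDeriv (fun y ↦ dirDeriv h y (ext u y)) x v := by
  set φ := extChartAt (𝓡 6) x
  set F := h ∘ φ.symm
  have hx : x ∈ (chartAt (EuclideanSpace ℝ (Fin 6)) x).source := mem_chart_source _ x
  have hh₂ : ContMDiffAt (𝓡 6) 𝓘(ℝ, V) 2 h x := hh.of_le (by norm_cast)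
  have hF : ContDiffAt ℝ 2 F (φ x) := contDiffAt_comp_extChartAt_symm (n := 2) hx hh₂
  have near : ∀ᶠ y in nhds x, ContMDiffAt (𝓡 6) 𝓘(ℝ, V) 2 h y :=
    (contMDiffAt_iff_contMDiffAt_nhds (by simp)).1 hh₂
  have key : ∀ w : Tan x, (fun y ↦ dirDeriv h y (ext w y))
      =ᶠ[nhds x] (fun q ↦ fderiv ℝ F q (coordAt x w)) ∘ φ := by
    intro w
    filter_upwards [near, chart_source_mem_nhds x] with y hy hy'
    rw [dirDeriv_congr (eventuallyEq_comp_extChartAt h hy')]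
    exact dirDeriv_comp_extChartAt w hy'
      ((contDiffAt_comp_extChartAt_symm (n := 2) hy' hy).differentiableAt two_ne_zero)
  have hdF : DifferentiableAt ℝ (fderiv ℝ F) (φ x) :=
    (hF.fderiv_right (m := 1) (by norm_num)).differentiableAt one_ne_zero
  have second : ∀ w z : Tan x, dirDeriv (fun y ↦ dirDeriv h y (ext w y)) x z
      = fderiv ℝ (fderiv ℝ F) (φ x) (coordAt x z) (coordAt x w) := by
    intro w z
    have := dirDeriv_comp_extChartAt z hx (F := fun q ↦ fderiv ℝ F q (coordAt x w))
      (hdF.clm_apply (differentiableAt_const _))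
    rw [ext_self] at this
    rw [dirDeriv_congr (key w), this, fderiv_clm_apply hdF (differentiableAt_const _)]
    simp [φ]
  rw [second, second]
  exact (hF.isSymmSndFDerivAt (by simp)) _ _

/-- Near `y` both fields are pullbacks of constant fields under the chart, and brackets commute with
pullback. -/
lemma mlieBracket_ext {x : M} (u v : Tan x) {y : M}
    (hy : y ∈ (chartAt (EuclideanSpace ℝ (Fin 6)) x).source) :
    VectorField.mlieBracket (𝓡 6) (ext u) (ext v) y = 0 := by
  set φ := extChartAt (𝓡 6) x with hφ
  let c (w : Tan x) : Π q : EuclideanSpace ℝ (Fin 6),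
    TangentSpace 𝓘(ℝ, EuclideanSpace ℝ (Fin 6)) q := fun _ ↦ coordAt x w
  have pull : ∀ w : Tan x, ∀ z ∈ (chartAt (EuclideanSpace ℝ (Fin 6)) x).source,
      VectorField.mpullback (𝓡 6) 𝓘(ℝ, EuclideanSpace ℝ (Fin 6)) φ (c w) z = ext w z := by
    intro w z hz
    rw [VectorField.mpullback_apply]
    have hinv := isInvertible_mfderiv_extChartAt (I := 𝓡 6) (x := x) (y := z)
      (by rwa [extChartAt_source])
    have : c w (φ z) = mfderiv (𝓡 6) 𝓘(ℝ, EuclideanSpace ℝ (Fin 6)) φ z (ext w z) :=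
      (mvfderiv_extChartAt_ext w hz).symm
    rw [this, hinv.inverse_apply_self]
  have near : ∀ w : Tan x, ext w =ᶠ[nhds y]
      VectorField.mpullback (𝓡 6) 𝓘(ℝ, EuclideanSpace ℝ (Fin 6)) φ (c w) := by
    intro w
    filter_upwards [(chartAt _ x).open_source.mem_nhds hy] with z hz
    exact (pull w z hz).symm
  have hc : ∀ w : Tan x, MDifferentiableAt 𝓘(ℝ, EuclideanSpace ℝ (Fin 6))
      (𝓘(ℝ, EuclideanSpace ℝ (Fin 6)).prod 𝓘(ℝ, EuclideanSpace ℝ (Fin 6)))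
      (fun q ↦ TotalSpace.mk' (EuclideanSpace ℝ (Fin 6)) q (c w q)) (φ y) := by
    intro w
    exact (contMDiffAt_vectorSpace_iff_contDiffAt.2
      (contDiffAt_const (n := 1))).mdifferentiableAt one_ne_zero
  have : IsManifold (𝓡 6) (minSmoothness ℝ 2) M := by
    rw [minSmoothness_of_isRCLikeNormedField]; infer_instance
  rw [(near u).mlieBracket_vectorField_eq (near v),
    ← VectorField.mpullback_mlieBracket (n := 2) (hc u) (hc v)
      (contMDiffAt_extChartAt' hy) (by simp)]
  have zero : VectorField.mlieBracket 𝓘(ℝ, EuclideanSpace ℝ (Fin 6)) (c u) (c v) = 0 := by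
    rw [← VectorField.mlieBracketWithin_univ,
      VectorField.mlieBracketWithin_eq_lieBracketWithin]
    funext q
    simp [VectorField.lieBracketWithin, c]
    rfl
  rw [zero]
  simp

end VectorFields

end SU3Torsion

end

noncomputable section

namespace SU3Torsion

/-! ### Torsion, its covariant derivative, and the first Bianchi identity -/

section Fields

variable {M : Type*} [TopologicalSpace M] [ChartedSpace (EuclideanSpace ℝ (Fin 6)) M]
  [IsManifold (𝓡 6) ∞ M] {x : M}

/-! ### Differentiable vector fields -/

lemma DiffAt.add {X Y : Π y : M, Tan y} (hX : DiffAt X x) (hY : DiffAt Y x) :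
    DiffAt (fun y ↦ X y + Y y) x :=
  mdifferentiableAt_add_section hX hY

lemma DiffAt.sub {X Y : Π y : M, Tan y} (hX : DiffAt X x) (hY : DiffAt Y x) :
    DiffAt (fun y ↦ X y - Y y) x :=
  mdifferentiableAt_sub_section hX hY

lemma DiffAt.smul {f : M → ℝ} {X : Π y : M, Tan y} (hf : MDifferentiableAt (𝓡 6) 𝓘(ℝ, ℝ) f x)
    (hX : DiffAt X x) : DiffAt (fun y ↦ f y • X y) x :=
  MDifferentiableAt.smul_section hf hX

lemma DiffAt.sum {ι : Type*} {s : Finset ι} {X : ι → Π y : M, Tan y}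
    (hX : ∀ i ∈ s, DiffAt (X i) x) : DiffAt (fun y ↦ ∑ i ∈ s, X i y) x :=
  MDifferentiableAt.sum_section hX

lemma DiffAt.congr {X Y : Π y : M, Tan y} (hX : DiffAt X x) (h : ∀ᶠ y in nhds x, Y y = X y) :
    DiffAt Y x :=
  MDifferentiableAt.congr_of_eventuallyEq hX (h.mono fun y hy ↦ by simp [hy])

lemma SmoothAt.congr {X Y : Π y : M, Tan y} (hX : SmoothAt X x) (h : ∀ᶠ y in nhds x, Y y = X y) :
    SmoothAt Y x :=
  ContMDiffAt.congr_of_eventuallyEq hX (h.mono fun y hy ↦ by simp [hy])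

lemma SmoothAt.sub {X Y : Π y : M, Tan y} (hX : SmoothAt X x) (hY : SmoothAt Y x) :
    SmoothAt (fun y ↦ X y - Y y) x :=
  ContMDiffAt.sub_section hX hY

lemma SmoothEnd.smoothAt {J : Π x : M, Tan x →L[ℝ] Tan x} (hJ : SmoothEnd J)
    {X : Π y : M, Tan y} (hX : SmoothAt X x) : SmoothAt (fun y ↦ J y (X y)) x :=
  ContMDiffAt.clm_bundle_apply (hJ x) hX

lemma SmoothEnd.diffAt {J : Π x : M, Tan x →L[ℝ] Tan x} (hJ : SmoothEnd J)
    {X : Π y : M, Tan y} (hX : DiffAt X x) : DiffAt (fun y ↦ J y (X y)) x :=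
  MDifferentiableAt.clm_bundle_apply ((hJ x).mdifferentiableAt (by simp)) hX

/-- A differentiable vector field is a combination of coordinate fields. -/
lemma DiffAt.exists_eq_sum {Y : Π y : M, Tan y} (hY : DiffAt Y x) :
    ∃ (v : Fin 6 → Tan x) (c : Fin 6 → M → ℝ),
      (∀ i, MDifferentiableAt (𝓡 6) 𝓘(ℝ, ℝ) (c i) x) ∧
        ∀ᶠ y in nhds x, Y y = ∑ i, c i y • ext (v i) y := by
  let t := trivializationAt (EuclideanSpace ℝ (Fin 6)) (TangentSpace (𝓡 6) : M → Type) x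
  let b := (EuclideanSpace.basisFun (Fin 6) ℝ).toBasis
  have hx : x ∈ t.baseSet := FiberBundle.mem_baseSet_trivializationAt' x
  refine ⟨fun i ↦ t.localFrame b i x, fun i ↦ LinearMap.piApply (t.localFrameCoeff (𝓡 6) b i) Y,
    fun i ↦ mdifferentiableAt_localFrameCoeff b hx hY i, ?_⟩
  filter_upwards [t.eventually_eq_localFrame_sum_coeff_smul (I := 𝓡 6) b (s := Y) hx,
    t.open_baseSet.mem_nhds hx] with y hy hy'
  rw [hy]
  refine Finset.sum_congr rfl fun i _ ↦ ?_
  have key : ∀ z (hz : z ∈ t.baseSet), t.localFrame b i z = t.symmL ℝ z (b i) := by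
    intro z hz
    rw [Bundle.Trivialization.localFrame_apply_of_mem_baseSet _ _ hz,
      Bundle.Trivialization.basisAt, Module.Basis.map_apply, Bundle.Trivialization.symmL_apply _ hz]
    rfl
  have : coordAt x (t.localFrame b i x) = b i := by
    rw [key x hx]
    exact Bundle.Trivialization.continuousLinearMapAt_symmL _ hx _
  rw [ext_eq_symmL _ hy', this, key y hy']
  rfl

/-! ### Connections -/

variable {cov : CovariantDerivative (𝓡 6) (EuclideanSpace ℝ (Fin 6)) (fun x : M ↦ Tan x)}

lemma cov_add {X Y : Π y : M, Tan y} (hX : DiffAt X x) (hY : DiffAt Y x) (v : Tan x) :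
    cov (fun y ↦ X y + Y y) x v = cov X x v + cov Y x v := by
  have := cov.isCovariantDerivativeOn.add (x := x) hX hY
  exact congrArg (fun A ↦ A v) this

lemma cov_smul {f : M → ℝ} {X : Π y : M, Tan y} (hf : MDifferentiableAt (𝓡 6) 𝓘(ℝ, ℝ) f x)
    (hX : DiffAt X x) (v : Tan x) :
    cov (fun y ↦ f y • X y) x v = f x • cov X x v + dirDeriv f x v • X x := by
  have := cov.isCovariantDerivativeOn.leibniz (x := x) hX hf
  exact congrArg (fun A ↦ A v) this

lemma cov_sub {X Y : Π y : M, Tan y} (hX : DiffAt X x) (hY : DiffAt Y x) (v : Tan x) :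
    cov (fun y ↦ X y - Y y) x v = cov X x v - cov Y x v := by
  have h := cov_add (cov := cov) (hX.sub hY) hY v
  simp only [sub_add_cancel] at h
  rw [h, add_sub_cancel_right]

lemma cov_congr {X Y : Π y : M, Tan y} (hX : DiffAt X x) (h : ∀ᶠ y in nhds x, Y y = X y) :
    cov Y x = cov X x :=
  cov.isCovariantDerivativeOn.congr_of_eventuallyEq (s := Set.univ) (hX.congr h) hX
    Filter.univ_mem h

/-- Smoothness of a connection concerns its action on globally smooth sections; a bump function
extends `Y` to one, and locality of `cov` removes the bump function again. -/
lemma eventually_smoothAt_cov [T2Space M]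
    (hcov : CovariantDerivative.ContMDiffCovariantDerivative cov ∞)
    {X Y : Π y : M, Tan y} (hX : ∀ᶠ y in nhds x, SmoothAt X y) (hY : ∀ᶠ y in nhds x, SmoothAt Y y) :
    ∀ᶠ y in nhds x, SmoothAt (fun y ↦ cov Y y (X y)) y := by
  obtain ⟨U, hU, hUo, hxU⟩ := eventually_nhds_iff.1 hY
  obtain ⟨ψ, -, hψ⟩ := (SmoothBumpFunction.nhds_basis_tsupport (I := 𝓡 6) x).mem_iff.1
    (hUo.mem_nhds hxU)
  have hσ : ContMDiff (𝓡 6) ((𝓡 6).prod 𝓘(ℝ, EuclideanSpace ℝ (Fin 6))) ∞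
      (fun y ↦ TotalSpace.mk' (EuclideanSpace ℝ (Fin 6)) y (((ψ : M → ℝ) • Y) y)) :=
    ContMDiffOn.smul_section_of_tsupport (u := U) ψ.contMDiff.contMDiffOn hUo hψ
      (fun y hy ↦ ContMDiffAt.contMDiffWithinAt (hU y hy))
  have H := hcov.contMDiff.contMDiff (σ := (ψ : M → ℝ) • Y) (hσ.contMDiffOn)
  rw [contMDiffOn_univ] at H
  have h1 : ∀ᶠ y in nhds x, ψ =ᶠ[nhds y] 1 := ψ.eventuallyEq_one.eventually_nhds
  filter_upwards [hX, hY.eventually_nhds, h1.eventually_nhds] with y hXy hYy h1y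
  have : SmoothAt (fun y ↦ cov ((ψ : M → ℝ) • Y) y (X y)) y :=
    ContMDiffAt.clm_bundle_apply (H y) hXy
  refine this.congr ?_
  filter_upwards [hYy, h1y] with z hz hz'
  rw [cov_congr (x := z) (X := Y) (Y := (ψ : M → ℝ) • Y) hz.diffAt]
  filter_upwards [hz'] with w hw
  simp [hw]

lemma eventually_smoothAt_ext (v : Tan x) : ∀ᶠ y in nhds x, SmoothAt (ext v) y :=
  (chart_source_mem_nhds x).mono fun _ hy ↦ smoothAt_ext v hy

lemma torsion_ext (v w : Tan x) {y : M}
    (hy : y ∈ (chartAt (EuclideanSpace ℝ (Fin 6)) x).source) :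
    cov.torsion y (ext v y) (ext w y) = cov (ext w) y (ext v y) - cov (ext v) y (ext w y) := by
  rw [cov.torsion_apply (smoothAt_ext v hy).diffAt (smoothAt_ext w hy).diffAt,
    mlieBracket_ext v w hy, sub_zero]

lemma eventually_smoothAt_torsion_ext [T2Space M]
    (hcov : CovariantDerivative.ContMDiffCovariantDerivative cov ∞) (v w : Tan x) :
    ∀ᶠ y in nhds x, SmoothAt (fun y ↦ cov.torsion y (ext v y) (ext w y)) y := by
  filter_upwards [eventually_smoothAt_cov hcov (eventually_smoothAt_ext v)
      (eventually_smoothAt_ext w), eventually_smoothAt_cov hcov (eventually_smoothAt_ext w)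
      (eventually_smoothAt_ext v), (chart_source_mem_nhds x).eventually_nhds] with y h₁ h₂ h₃
  exact (h₁.sub h₂).congr (h₃.mono fun z hz ↦ torsion_ext v w hz)

/-- The bracket of merely differentiable fields need not be differentiable. Tensoriality allows the
torsion to be evaluated on coordinate fields, where it is smooth, with differentiable coefficients.
-/
lemma diffAt_torsion [T2Space M]
    (hcov : CovariantDerivative.ContMDiffCovariantDerivative cov ∞) {Y Z : Π y : M, Tan y}
    (hY : DiffAt Y x) (hZ : DiffAt Z x) : DiffAt (fun y ↦ cov.torsion y (Y y) (Z y)) x := by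
  obtain ⟨v, c, hc, hYc⟩ := hY.exists_eq_sum
  obtain ⟨w, d, hd, hZd⟩ := hZ.exists_eq_sum
  have : DiffAt (fun y ↦ ∑ i, c i y • ∑ j, d j y • cov.torsion y (ext (v i) y) (ext (w j) y)) x :=
    DiffAt.sum fun i _ ↦ DiffAt.smul (hc i) (DiffAt.sum fun j _ ↦ DiffAt.smul (hd j)
      (eventually_smoothAt_torsion_ext hcov (v i) (w j)).self_of_nhds.diffAt)
  refine this.congr ?_
  filter_upwards [hYc, hZd] with y h₁ h₂
  rw [h₁, h₂]
  simp only [map_sum, map_smul, FunLike.coe_sum, Finset.sum_apply,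
    smul_apply, Finset.smul_sum]
  rw [Finset.sum_comm]
  exact Finset.sum_congr rfl fun i _ ↦ Finset.sum_congr rfl fun j _ ↦ smul_comm _ _ _

/-- The covariant derivative of the torsion, `(∇_z T)(u, v)`. -/
def covTorsion [T2Space M] (hcov : CovariantDerivative.ContMDiffCovariantDerivative cov ∞) (x : M)
    (z : Tan x) : Tan x →L[ℝ] Tan x →L[ℝ] Tan x :=
  TensorialAt.mkHom₂ (I := 𝓡 6) (F := EuclideanSpace ℝ (Fin 6)) (F' := EuclideanSpace ℝ (Fin 6))
    (fun Y Z ↦ cov (fun y ↦ cov.torsion y (Y y) (Z y)) x z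
      - cov.torsion x (cov Y x z) (Z x) - cov.torsion x (Y x) (cov Z x z)) x
    (fun Z hZ ↦
      { smul := fun {f Y} hf hY ↦ by
          have h₁ := cov_smul (cov := cov) hf (diffAt_torsion hcov hY hZ) z
          have h₂ := cov_smul (cov := cov) hf hY z
          have e₁ : (fun y ↦ cov.torsion y ((f • Y) y) (Z y))
              = fun y ↦ f y • cov.torsion y (Y y) (Z y) := by
            funext y; simp
          have e₂ : (f • Y) = fun y ↦ f y • Y y := rfl
          rw [e₁, h₁, e₂, h₂]
          simp only [map_add, map_smul, add_apply,
            smul_apply]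
          module
        add := fun {Y Y'} hY hY' ↦ by
          have h₁ := cov_add (cov := cov) (diffAt_torsion hcov hY hZ) (diffAt_torsion hcov hY' hZ) z
          have h₂ := cov_add (cov := cov) hY hY' z
          have e₁ : (fun y ↦ cov.torsion y ((Y + Y') y) (Z y))
              = fun y ↦ cov.torsion y (Y y) (Z y) + cov.torsion y (Y' y) (Z y) := by
            funext y; simp
          have e₂ : (Y + Y') = fun y ↦ Y y + Y' y := rfl
          rw [e₁, h₁, e₂, h₂]
          simp only [map_add, add_apply]
          module })
    (fun Y hY ↦
      { smul := fun {f Z} hf hZ ↦ by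
          have h₁ := cov_smul (cov := cov) hf (diffAt_torsion hcov hY hZ) z
          have h₂ := cov_smul (cov := cov) hf hZ z
          have e₁ : (fun y ↦ cov.torsion y (Y y) ((f • Z) y))
              = fun y ↦ f y • cov.torsion y (Y y) (Z y) := by
            funext y; simp
          have e₂ : (f • Z) = fun y ↦ f y • Z y := rfl
          rw [e₁, h₁, e₂, h₂]
          simp only [map_add, map_smul]
          module
        add := fun {Z Z'} hZ hZ' ↦ by
          have h₁ := cov_add (cov := cov) (diffAt_torsion hcov hY hZ) (diffAt_torsion hcov hY hZ') z
          have h₂ := cov_add (cov := cov) hZ hZ' z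
          have e₁ : (fun y ↦ cov.torsion y (Y y) ((Z + Z') y))
              = fun y ↦ cov.torsion y (Y y) (Z y) + cov.torsion y (Y y) (Z' y) := by
            funext y; simp
          have e₂ : (Z + Z') = fun y ↦ Z y + Z' y := rfl
          rw [e₁, h₁, e₂, h₂]
          simp only [map_add]
          module })

lemma covTorsion_apply [T2Space M]
    (hcov : CovariantDerivative.ContMDiffCovariantDerivative cov ∞) (z : Tan x)
    {Y Z : Π y : M, Tan y} (hY : DiffAt Y x) (hZ : DiffAt Z x) :
    covTorsion hcov x z (Y x) (Z x) = cov (fun y ↦ cov.torsion y (Y y) (Z y)) x z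
      - cov.torsion x (cov Y x z) (Z x) - cov.torsion x (Y x) (cov Z x z) :=
  TensorialAt.mkHom₂_apply _ _ hY hZ

lemma covTorsion_eq [T2Space M]
    (hcov : CovariantDerivative.ContMDiffCovariantDerivative cov ∞) (z u v : Tan x) :
    covTorsion hcov x z u v = cov (fun y ↦ cov.torsion y (ext u y) (ext v y)) x z
      - cov.torsion x (cov (ext u) x z) v - cov.torsion x u (cov (ext v) x z) := by
  have := covTorsion_apply hcov z (diffAt_ext u) (diffAt_ext v)
  simpa using this

/-- The curvature `R(u, v)Y` of a connection. -/
def curv (cov : CovariantDerivative (𝓡 6) (EuclideanSpace ℝ (Fin 6)) (fun x : M ↦ Tan x)) (x : M)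
    (u v : Tan x) (Y : Π y : M, Tan y) : Tan x :=
  -- The term $\nabla_{[u,v]}Y$ is absent because the coordinate extensions commute.
  cov (fun y ↦ cov Y y (ext v y)) x u - cov (fun y ↦ cov Y y (ext u y)) x v

/-- For commuting fields $T(a,b)=\nabla_ab-\nabla_ba$. Differentiating this and summing cyclically
gives the curvatures, and the correction terms of $\nabla T$ combine into $T(T(\cdot,\cdot),\cdot)$.
-/
lemma curv_bianchi [T2Space M]
    (hcov : CovariantDerivative.ContMDiffCovariantDerivative cov ∞) (u v w : Tan x) :
    curv cov x u v (ext w) + curv cov x v w (ext u) + curv cov x w u (ext v)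
      = covTorsion hcov x u v w + covTorsion hcov x v w u + covTorsion hcov x w u v
        + (cov.torsion x (cov.torsion x u v) w + cov.torsion x (cov.torsion x v w) u
          + cov.torsion x (cov.torsion x w u) v) := by
  have D : ∀ a b : Tan x, DiffAt (fun y ↦ cov (ext b) y (ext a y)) x := fun a b ↦
    (eventually_smoothAt_cov hcov (eventually_smoothAt_ext a)
      (eventually_smoothAt_ext b)).self_of_nhds.diffAt
  have key : ∀ a b c : Tan x, cov (fun y ↦ cov.torsion y (ext a y) (ext b y)) x c
      = cov (fun y ↦ cov (ext b) y (ext a y)) x c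
        - cov (fun y ↦ cov (ext a) y (ext b y)) x c := by
    intro a b c
    rw [← cov_sub (D a b) (D b a) c]
    rw [cov_congr ((D a b).sub (D b a))
      ((chart_source_mem_nhds x).mono fun z hz ↦ torsion_ext a b hz)]
  have tor : ∀ a b : Tan x, cov.torsion x a b = cov (ext b) x a - cov (ext a) x b := by
    intro a b
    have := torsion_ext (cov := cov) a b (mem_chart_source _ x)
    simpa using this
  have anti : ∀ a b : Tan x, cov.torsion x a b = -cov.torsion x b a := cov.torsion_antisymm
  simp only [covTorsion_eq, key, curv]
  rw [tor u v, tor v w, tor w u]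
  simp only [map_sub, sub_apply]
  rw [anti v (cov (ext w) x u), anti w (cov (ext u) x v), anti u (cov (ext v) x w)]
  abel

end Fields

end SU3Torsion

end

noncomputable section

namespace SU3Torsion

section DirDeriv

variable {M : Type*} [TopologicalSpace M] [ChartedSpace (EuclideanSpace ℝ (Fin 6)) M] {x : M}
  {V : Type*} [NormedAddCommGroup V] [NormedSpace ℝ V]

lemma dirDeriv_add {f g : M → V} (hf : MDifferentiableAt (𝓡 6) 𝓘(ℝ, V) f x)
    (hg : MDifferentiableAt (𝓡 6) 𝓘(ℝ, V) g x) (z : Tan x) :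
    dirDeriv (fun y ↦ f y + g y) x z = dirDeriv f x z + dirDeriv g x z := by
  simp [dirDeriv, mvfderiv_fun_add hf hg]

lemma dirDeriv_sub {f g : M → V} (hf : MDifferentiableAt (𝓡 6) 𝓘(ℝ, V) f x)
    (hg : MDifferentiableAt (𝓡 6) 𝓘(ℝ, V) g x) (z : Tan x) :
    dirDeriv (fun y ↦ f y - g y) x z = dirDeriv f x z - dirDeriv g x z := by
  simp [dirDeriv, mvfderiv_fun_sub hf hg]

lemma dirDeriv_add₃ {f g k : M → V} (hf : MDifferentiableAt (𝓡 6) 𝓘(ℝ, V) f x)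
    (hg : MDifferentiableAt (𝓡 6) 𝓘(ℝ, V) g x) (hk : MDifferentiableAt (𝓡 6) 𝓘(ℝ, V) k x)
    (z : Tan x) : dirDeriv (fun y ↦ f y + g y + k y) x z
      = dirDeriv f x z + dirDeriv g x z + dirDeriv k x z := by
  rw [← dirDeriv_add hf hg]
  exact dirDeriv_add (f := fun y ↦ f y + g y) (hf.add hg) hk z

end DirDeriv

/-! ### The curvature annihilates $g$, $J$ and $\Psi$ -/

section Riemannian

variable {M : Type*} [TopologicalSpace M] [ChartedSpace (EuclideanSpace ℝ (Fin 6)) M]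
  [IsManifold (𝓡 6) ∞ M] [RiemannianBundle (fun x : M ↦ Tan x)]
  [IsContMDiffRiemannianBundle (𝓡 6) ∞ (EuclideanSpace ℝ (Fin 6)) (fun x : M ↦ Tan x)]
  {x : M}

lemma DiffAt.inner {Y Z : Π y : M, Tan y} (hY : DiffAt Y x) (hZ : DiffAt Z x) :
    MDifferentiableAt (𝓡 6) 𝓘(ℝ, ℝ) (fun y ↦ ⟪Y y, Z y⟫_ℝ) x :=
  MDifferentiableAt.inner_bundle hY hZ

lemma SmoothAt.inner {Y Z : Π y : M, Tan y} (hY : SmoothAt Y x) (hZ : SmoothAt Z x) :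
    ContMDiffAt (𝓡 6) 𝓘(ℝ, ℝ) ∞ (fun y ↦ ⟪Y y, Z y⟫_ℝ) x :=
  ContMDiffAt.inner_bundle hY hZ

variable {J : Π x : M, Tan x →L[ℝ] Tan x} {Ψ : Π x : M, Tan x [⋀^Fin 3]→L[ℝ] ℂ}
  {cov : CovariantDerivative (𝓡 6) (EuclideanSpace ℝ (Fin 6)) (fun x : M ↦ Tan x)}

omit [IsContMDiffRiemannianBundle (𝓡 6) ∞ (EuclideanSpace ℝ (Fin 6)) (fun x : M ↦ Tan x)] in
lemma IsSU3Structure.smoothAt_form (h : IsSU3Structure J Ψ) {A B C : Π y : M, Tan y}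
    (hA : SmoothAt A x) (hB : SmoothAt B x) (hC : SmoothAt C x) :
    ContMDiffAt (𝓡 6) 𝓘(ℝ, ℂ) ∞ (fun y ↦ Ψ y ![A y, B y, C y]) x := by
  have := h.smooth_Ψ x ![A, B, C] (by intro k; fin_cases k <;> assumption)
  have e : ∀ y, (fun k ↦ (![A, B, C] : Fin 3 → Π y : M, Tan y) k y) = ![A y, B y, C y] := by
    intro y; funext k; fin_cases k <;> rfl
  simpa only [e] using this

namespace IsACYT

lemma dirDeriv_inner (h : IsACYT J Ψ cov) {Y Z : Π y : M, Tan y} (hY : DiffAt Y x)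
    (hZ : DiffAt Z x) (z : Tan x) :
    dirDeriv (fun y ↦ ⟪Y y, Z y⟫_ℝ) x z = ⟪cov Y x z, Z x⟫_ℝ + ⟪Y x, cov Z x z⟫_ℝ := by
  have := h.metric.mvfderiv_inner_eq (ext z) hY hZ
  simp only [ext_self] at this
  exact this

lemma cov_J (h : IsACYT J Ψ cov) {Y : Π y : M, Tan y} (hY : DiffAt Y x) (z : Tan x) :
    cov (fun y ↦ J y (Y y)) x z = J x (cov Y x z) :=
  sub_eq_zero.1 (h.parallel_J x z Y hY)

lemma dirDeriv_form (h : IsACYT J Ψ cov) {A B C : Π y : M, Tan y} (hA : DiffAt A x)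
    (hB : DiffAt B x) (hC : DiffAt C x) (z : Tan x) :
    dirDeriv (fun y ↦ Ψ y ![A y, B y, C y]) x z
      = Ψ x ![cov A x z, B x, C x] + Ψ x ![A x, cov B x z, C x] + Ψ x ![A x, B x, cov C x z] := by
  have := h.parallel_Ψ x z ![A, B, C] (by intro k; fin_cases k <;> assumption)
  rw [sub_eq_zero] at this
  have e : ∀ y, (fun k ↦ (![A, B, C] : Fin 3 → Π y : M, Tan y) k y) = ![A y, B y, C y] := by
    intro y; funext k; fin_cases k <;> rfl
  simp only [e] at this
  rw [this, Fin.sum_univ_three]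
  congr 2 <;> [congr 2; skip; skip] <;> (congr 1; funext k; fin_cases k <;> rfl)

variable [T2Space M]

lemma diffAt_cov (h : IsACYT J Ψ cov) {Y : Π y : M, Tan y} (hY : ∀ᶠ y in nhds x, SmoothAt Y y)
    (v : Tan x) : DiffAt (fun y ↦ cov Y y (ext v y)) x :=
  (eventually_smoothAt_cov h.smooth_cov (eventually_smoothAt_ext v) hY).self_of_nhds.diffAt

/-- In second derivatives of a parallel pairing the mixed first-order terms are symmetric in the two
directions, so `dirDeriv_symm` leaves only curvature. The argument for `curv_form` is the same. -/
lemma curv_inner (h : IsACYT J Ψ cov) {Y Z : Π y : M, Tan y}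
    (hY : ∀ᶠ y in nhds x, SmoothAt Y y) (hZ : ∀ᶠ y in nhds x, SmoothAt Z y) (u v : Tan x) :
    ⟪curv cov x u v Y, Z x⟫_ℝ + ⟪Y x, curv cov x u v Z⟫_ℝ = 0 := by
  have second : ∀ a b : Tan x, dirDeriv (fun y ↦ dirDeriv (fun y ↦ ⟪Y y, Z y⟫_ℝ) y (ext b y)) x a
      = ⟪cov (fun y ↦ cov Y y (ext b y)) x a, Z x⟫_ℝ + ⟪cov Y x b, cov Z x a⟫_ℝ
        + (⟪cov Y x a, cov Z x b⟫_ℝ + ⟪Y x, cov (fun y ↦ cov Z y (ext b y)) x a⟫_ℝ) := by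
    intro a b
    have e : (fun y ↦ dirDeriv (fun y ↦ ⟪Y y, Z y⟫_ℝ) y (ext b y)) =ᶠ[nhds x]
        fun y ↦ ⟪cov Y y (ext b y), Z y⟫_ℝ + ⟪Y y, cov Z y (ext b y)⟫_ℝ := by
      filter_upwards [hY, hZ] with y hYy hZy
      exact h.dirDeriv_inner hYy.diffAt hZy.diffAt _
    have dY := hY.self_of_nhds.diffAt
    have dZ := hZ.self_of_nhds.diffAt
    rw [dirDeriv_congr e, dirDeriv_add ((h.diffAt_cov hY b).inner dZ)
      (dY.inner (h.diffAt_cov hZ b)), h.dirDeriv_inner (h.diffAt_cov hY b) dZ,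
      h.dirDeriv_inner dY (h.diffAt_cov hZ b)]
    simp
  have := dirDeriv_symm u v (hY.self_of_nhds.inner hZ.self_of_nhds)
  rw [second, second] at this
  simp only [curv, inner_sub_left, inner_sub_right]
  linarith

lemma curv_J (h : IsACYT J Ψ cov) {Y : Π y : M, Tan y} (hY : ∀ᶠ y in nhds x, SmoothAt Y y)
    (u v : Tan x) : curv cov x u v (fun y ↦ J y (Y y)) = J x (curv cov x u v Y) := by
  have key : ∀ a b : Tan x, cov (fun y ↦ cov (fun y ↦ J y (Y y)) y (ext b y)) x a
      = J x (cov (fun y ↦ cov Y y (ext b y)) x a) := by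
    intro a b
    rw [← h.cov_J (h.diffAt_cov hY b)]
    rw [cov_congr (h.su3.smooth_J.diffAt (h.diffAt_cov hY b))]
    filter_upwards [hY] with y hy using h.cov_J hy.diffAt _
  simp only [curv, key, map_sub]

lemma curv_form (h : IsACYT J Ψ cov) {A B C : Π y : M, Tan y}
    (hA : ∀ᶠ y in nhds x, SmoothAt A y) (hB : ∀ᶠ y in nhds x, SmoothAt B y)
    (hC : ∀ᶠ y in nhds x, SmoothAt C y) (u v : Tan x) :
    Ψ x ![curv cov x u v A, B x, C x] + Ψ x ![A x, curv cov x u v B, C x]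
      + Ψ x ![A x, B x, curv cov x u v C] = 0 := by
  have diff : ∀ {A B C : Π y : M, Tan y}, SmoothAt A x → SmoothAt B x → SmoothAt C x →
      MDifferentiableAt (𝓡 6) 𝓘(ℝ, ℂ) (fun y ↦ Ψ y ![A y, B y, C y]) x :=
    fun hA hB hC ↦ (h.su3.smoothAt_form hA hB hC).mdifferentiableAt (by simp)
  have sA := hA.self_of_nhds
  have sB := hB.self_of_nhds
  have sC := hC.self_of_nhds
  have sc : ∀ {Y : Π y : M, Tan y} (_ : ∀ᶠ y in nhds x, SmoothAt Y y) (b : Tan x),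
      SmoothAt (fun y ↦ cov Y y (ext b y)) x := fun hY b ↦
    (eventually_smoothAt_cov h.smooth_cov (eventually_smoothAt_ext b) hY).self_of_nhds
  have second : ∀ a b : Tan x,
      dirDeriv (fun y ↦ dirDeriv (fun y ↦ Ψ y ![A y, B y, C y]) y (ext b y)) x a
      = (Ψ x ![cov (fun y ↦ cov A y (ext b y)) x a, B x, C x]
          + Ψ x ![cov A x b, cov B x a, C x] + Ψ x ![cov A x b, B x, cov C x a])
        + (Ψ x ![cov A x a, cov B x b, C x]
          + Ψ x ![A x, cov (fun y ↦ cov B y (ext b y)) x a, C x]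
          + Ψ x ![A x, cov B x b, cov C x a])
        + (Ψ x ![cov A x a, B x, cov C x b] + Ψ x ![A x, cov B x a, cov C x b]
          + Ψ x ![A x, B x, cov (fun y ↦ cov C y (ext b y)) x a]) := by
    intro a b
    have e : (fun y ↦ dirDeriv (fun y ↦ Ψ y ![A y, B y, C y]) y (ext b y)) =ᶠ[nhds x]
        fun y ↦ Ψ y ![cov A y (ext b y), B y, C y] + Ψ y ![A y, cov B y (ext b y), C y]
          + Ψ y ![A y, B y, cov C y (ext b y)] := by
      filter_upwards [hA, hB, hC] with y hAy hBy hCy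
      exact h.dirDeriv_form hAy.diffAt hBy.diffAt hCy.diffAt _
    rw [dirDeriv_congr e, dirDeriv_add₃ (diff (sc hA b) sB sC) (diff sA (sc hB b) sC)
      (diff sA sB (sc hC b)),
      h.dirDeriv_form (sc hA b).diffAt sB.diffAt sC.diffAt,
      h.dirDeriv_form sA.diffAt (sc hB b).diffAt sC.diffAt,
      h.dirDeriv_form sA.diffAt sB.diffAt (sc hC b).diffAt]
    simp
  have := dirDeriv_symm u v (h.su3.smoothAt_form sA sB sC)
  rw [second, second] at this
  have u₁ : ∀ a b c w : Tan x, Function.update ![a, b, c] 0 w = ![w, b, c] := by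
    intro a b c w; funext k; fin_cases k <;> rfl
  have u₂ : ∀ a b c w : Tan x, Function.update ![a, b, c] 1 w = ![a, w, c] := by
    intro a b c w; funext k; fin_cases k <;> rfl
  have u₃ : ∀ a b c w : Tan x, Function.update ![a, b, c] 2 w = ![a, b, w] := by
    intro a b c w; funext k; fin_cases k <;> rfl
  have s₁ : ∀ p q b c : Tan x, Ψ x ![p - q, b, c] = Ψ x ![p, b, c] - Ψ x ![q, b, c] := by
    intro p q b c
    simpa only [u₁] using (Ψ x).map_update_sub ![p, b, c] 0 p q
  have s₂ : ∀ p q a c : Tan x, Ψ x ![a, p - q, c] = Ψ x ![a, p, c] - Ψ x ![a, q, c] := by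
    intro p q a c
    simpa only [u₂] using (Ψ x).map_update_sub ![a, p, c] 1 p q
  have s₃ : ∀ p q a b : Tan x, Ψ x ![a, b, p - q] = Ψ x ![a, b, p] - Ψ x ![a, b, q] := by
    intro p q a b
    simpa only [u₃] using (Ψ x).map_update_sub ![a, b, p] 2 p q
  simp only [curv, s₁, s₂, s₃]
  linear_combination this

end IsACYT

end Riemannian

end SU3Torsion

end

noncomputable section

namespace SU3Torsion

/-! ### The torsion and curvature forms as pointwise Bianchi data -/

section Riemannian

variable {M : Type*} [TopologicalSpace M] [ChartedSpace (EuclideanSpace ℝ (Fin 6)) M]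
  [IsManifold (𝓡 6) ∞ M] [RiemannianBundle (fun x : M ↦ Tan x)] {x : M}
  {J : Π x : M, Tan x →L[ℝ] Tan x} {Ψ : Π x : M, Tan x [⋀^Fin 3]→L[ℝ] ℂ}
  {cov : CovariantDerivative (𝓡 6) (EuclideanSpace ℝ (Fin 6)) (fun x : M ↦ Tan x)}

lemma IsSU3Structure.exists_adapted (h : IsSU3Structure J Ψ) (x : M) :
    ∃ e : OrthonormalBasis (Fin 3 × Fin 2) ℝ (Tan x),
      (∀ j, J x (e (j, 0)) = e (j, 1)) ∧ ∀ v, Ψ x v = cplxVolume e v :=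
  h.adapted x

lemma IsSU3Structure.inner_J (h : IsSU3Structure J Ψ) (u v : Tan x) :
    ⟪J x u, v⟫_ℝ = -⟪u, J x v⟫_ℝ := by
  rw [← h.J_inner x u (J x v), h.J_sq, inner_neg_right, neg_neg]

variable [IsContMDiffRiemannianBundle (𝓡 6) ∞ (EuclideanSpace ℝ (Fin 6)) (fun x : M ↦ Tan x)]

namespace IsACYT

lemma torsion_swap₂₃ (h : IsACYT J Ψ cov) (u v w : Tan x) :
    ⟪cov.torsion x u v, w⟫_ℝ = -⟪cov.torsion x u w, v⟫_ℝ := h.torsion_skew x u v w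

omit [IsContMDiffRiemannianBundle (𝓡 6) ∞ (EuclideanSpace ℝ (Fin 6)) (fun x : M ↦ Tan x)] in
lemma torsion_swap₁₂ (u v w : Tan x) :
    ⟪cov.torsion x u v, w⟫_ℝ = -⟪cov.torsion x v u, w⟫_ℝ := by
  rw [cov.torsion_antisymm u v, inner_neg_left]

variable [T2Space M]

/-- The covariant derivative of the torsion form, `(∇_z t)(u, v, w)`. -/
def dTor (h : IsACYT J Ψ cov) (x : M) (z u v w : Tan x) : ℝ :=
  ⟪covTorsion h.smooth_cov x z u v, w⟫_ℝ

lemma dTor_apply (h : IsACYT J Ψ cov) {X Y Z : Π y : M, Tan y} (hX : DiffAt X x)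
    (hY : DiffAt Y x) (hZ : DiffAt Z x) (z : Tan x) :
    h.dTor x z (X x) (Y x) (Z x)
      = dirDeriv (fun y ↦ ⟪cov.torsion y (X y) (Y y), Z y⟫_ℝ) x z
        - ⟪cov.torsion x (cov X x z) (Y x), Z x⟫_ℝ - ⟪cov.torsion x (X x) (cov Y x z), Z x⟫_ℝ
        - ⟪cov.torsion x (X x) (Y x), cov Z x z⟫_ℝ := by
  rw [h.dirDeriv_inner (diffAt_torsion h.smooth_cov hX hY) hZ, dTor,
    covTorsion_apply h.smooth_cov z hX hY, inner_sub_left, inner_sub_left]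
  ring

lemma dTor_eq (h : IsACYT J Ψ cov) (z u v w : Tan x) :
    h.dTor x z u v w
      = dirDeriv (fun y ↦ ⟪cov.torsion y (ext u y) (ext v y), ext w y⟫_ℝ) x z
        - ⟪cov.torsion x (cov (ext u) x z) v, w⟫_ℝ - ⟪cov.torsion x u (cov (ext v) x z), w⟫_ℝ
        - ⟪cov.torsion x u v, cov (ext w) x z⟫_ℝ := by
  have := h.dTor_apply (diffAt_ext u) (diffAt_ext v) (diffAt_ext w) z
  simpa using this

omit [IsContMDiffRiemannianBundle (𝓡 6) ∞ (EuclideanSpace ℝ (Fin 6)) (fun x : M ↦ Tan x)]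
  [T2Space M] [RiemannianBundle (fun x : M ↦ Tan x)] [IsManifold (𝓡 6) ∞ M] in
lemma _root_.SU3Torsion.dirDeriv_neg {V : Type*} [NormedAddCommGroup V] [NormedSpace ℝ V]
    (f : M → V) (z : Tan x) : dirDeriv (fun y ↦ -f y) x z = -dirDeriv f x z := by
  simp [dirDeriv, mvfderiv_fun_neg]

lemma dTor_swap₁₂ (h : IsACYT J Ψ cov) (z u v w : Tan x) :
    h.dTor x z u v w = -h.dTor x z v u w := by
  rw [h.dTor_eq, h.dTor_eq, torsion_swap₁₂ (cov (ext u) x z), torsion_swap₁₂ u (cov (ext v) x z),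
    torsion_swap₁₂ u v]
  simp only [fun y ↦ torsion_swap₁₂ (cov := cov) (ext u y) (ext v y) (ext w y), dirDeriv_neg]
  ring

lemma dTor_swap₂₃ (h : IsACYT J Ψ cov) (z u v w : Tan x) :
    h.dTor x z u v w = -h.dTor x z u w v := by
  rw [h.dTor_eq, h.dTor_eq, h.torsion_swap₂₃ (cov (ext u) x z),
    h.torsion_swap₂₃ u (cov (ext v) x z), h.torsion_swap₂₃ u v]
  simp only [fun y ↦ h.torsion_swap₂₃ (ext u y) (ext v y) (ext w y), dirDeriv_neg]
  ring

/-- The curvature form of the torsion connection. -/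
def _root_.SU3Torsion.curvForm
    (cov : CovariantDerivative (𝓡 6) (EuclideanSpace ℝ (Fin 6)) (fun x : M ↦ Tan x)) (x : M)
    (u v w p : Tan x) : ℝ :=
  ⟪curv cov x u v (ext w), p⟫_ℝ

lemma curvForm_skew (h : IsACYT J Ψ cov) (u v w p : Tan x) :
    curvForm cov x u v w p = -curvForm cov x u v p w := by
  have := h.curv_inner (eventually_smoothAt_ext w) (eventually_smoothAt_ext p) u v
  rw [ext_self, ext_self, real_inner_comm (curv cov x u v (ext p))] at this
  simp only [curvForm]
  linarith

/-- Skewness is applied to the field $J(\mathrm{ext}\,w)$ itself, which avoids proving that the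
curvature is tensorial in its field argument. -/
lemma curvForm_J (h : IsACYT J Ψ cov) (u v w p : Tan x) :
    curvForm cov x u v w (J x p) = curvForm cov x u v p (J x w) := by
  have := h.curv_inner (Y := fun y ↦ J y (ext w y))
    ((eventually_smoothAt_ext w).mono fun y hy ↦ h.su3.smooth_J.smoothAt hy)
    (eventually_smoothAt_ext p) u v
  rw [h.curv_J (eventually_smoothAt_ext w), ext_self, ext_self, h.su3.inner_J,
    real_inner_comm (curv cov x u v (ext p))] at this
  simp only [curvForm]
  linarith

/-- On the vectors `e (k, 0)` the identity $R\cdot\Psi=0$ says that the complex trace of $R$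
vanishes; the sum is its imaginary part. -/
lemma curvForm_trace (h : IsACYT J Ψ cov) {e : OrthonormalBasis (Fin 3 × Fin 2) ℝ (Tan x)}
    (he : ∀ j, J x (e (j, 0)) = e (j, 1)) (hΨ : ∀ v, Ψ x v = cplxVolume e v) (u v : Tan x) :
    ∑ k, curvForm cov x u v (e (k, 0)) (J x (e (k, 0))) = 0 := by
  have H := h.curv_form (eventually_smoothAt_ext (e (0, 0))) (eventually_smoothAt_ext (e (1, 0)))
    (eventually_smoothAt_ext (e (2, 0))) u v
  simp only [ext_self, hΨ, cplxVolume, Matrix.det_fin_three, Matrix.of_apply] at H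
  simp [cplxCoord_basis] at H
  have := congrArg Complex.im H
  simp [cplxCoord] at this
  simp only [Fin.sum_univ_three, curvForm, he, real_inner_comm (e (_, 1))]
  linarith

omit [IsContMDiffRiemannianBundle (𝓡 6) ∞ (EuclideanSpace ℝ (Fin 6)) (fun x : M ↦ Tan x)]
  [T2Space M] in
lemma inner_torsion_torsion {e : OrthonormalBasis (Fin 3 × Fin 2) ℝ (Tan x)}
    (he : ∀ j, J x (e (j, 0)) = e (j, 1)) (u v w p : Tan x) :
    ⟪cov.torsion x (cov.torsion x u v) w, p⟫_ℝ
      = quadContr (J x) (fun u v w ↦ ⟪cov.torsion x u v, w⟫_ℝ) (fun k ↦ e (k, 0)) u v w p := by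
  conv_lhs => rw [eq_sum_adapted he (cov.torsion x u v)]
  simp only [quadContr, map_sum, map_add, map_smul, FunLike.coe_sum, Finset.sum_apply,
    add_apply, smul_apply, sum_inner, inner_add_left, inner_smul_left,
    real_inner_comm (cov.torsion x u v), he]
  simp

lemma bianchiData (h : IsACYT J Ψ cov) {e : OrthonormalBasis (Fin 3 × Fin 2) ℝ (Tan x)}
    (he : ∀ j, J x (e (j, 0)) = e (j, 1)) (hΨ : ∀ v, Ψ x v = cplxVolume e v) :
    BianchiData (J x) (fun u v w ↦ ⟪cov.torsion x u v, w⟫_ℝ) (h.dTor x) (curvForm cov x)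
      (fun k ↦ e (k, 0)) where
  J_sq := h.su3.J_sq x
  t_swap₁₂ := torsion_swap₁₂
  t_swap₂₃ := h.torsion_swap₂₃
  E_neg z u v w := by simp [dTor]
  E_swap₁₂ := h.dTor_swap₁₂
  E_swap₂₃ := h.dTor_swap₂₃
  r_neg u v w p := by simp [curvForm]
  r_skew := h.curvForm_skew
  r_J := h.curvForm_J
  r_trace := h.curvForm_trace he hΨ
  bianchi u v w p := by
    rw [← inner_torsion_torsion he, ← inner_torsion_torsion he, ← inner_torsion_torsion he]
    have := congrArg (fun q ↦ ⟪q, p⟫_ℝ) (curv_bianchi h.smooth_cov u v w)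
    simp only [inner_add_left] at this
    exact this

end IsACYT

end Riemannian

end SU3Torsion

end

noncomputable section

namespace SU3Torsion

/-! ### The $(3,0)$-part of the torsion and the Nijenhuis tensor -/

section NijenhuisPart

variable {V : Type*} [NormedAddCommGroup V] [InnerProductSpace ℝ V] {J : V →L[ℝ] V}
  {e : OrthonormalBasis (Fin 3 × Fin 2) ℝ V}

/-- `B(u,v) - B(Ju,Jv) + J B(Ju,v) + J B(u,Jv)`. -/
def nijPart (J : V →L[ℝ] V) (B : V →L[ℝ] V →L[ℝ] V) : V →L[ℝ] V →L[ℝ] V :=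
  B - B.bilinearComp J J
    + (ContinuousLinearMap.compL ℝ V V V J).comp (B.bilinearComp J (.id ℝ V))
    + (ContinuousLinearMap.compL ℝ V V V J).comp (B.bilinearComp (.id ℝ V) J)

lemma nijPart_apply (B : V →L[ℝ] V →L[ℝ] V) (u v : V) :
    nijPart J B u v = B u v - B (J u) (J v) + J (B (J u) v) + J (B u (J v)) := rfl

/-- The coefficient of the `(3,0)`-part of a 3-form. -/
def coeff₃₀ (J : V →L[ℝ] V) (e : OrthonormalBasis (Fin 3 × Fin 2) ℝ V)
    (B : V →L[ℝ] V →L[ℝ] V) : ℂ :=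
  -cplx₃ J (fun u v w ↦ ⟪B u v, w⟫_ℝ) (e (0, 0)) (-Complex.I) (e (1, 0)) (-Complex.I)
    (e (2, 0)) (-Complex.I)

/-- The right side is the real part of the complexified form at $u-iJu,v-iJv,w-iJw$; moving `J`
across the inner product gives `nijPart`. The sign in `coeff₃₀` reflects that the volume form is
$-1$ on the basis. -/
lemma inner_nijPart (he : ∀ j, J (e (j, 0)) = e (j, 1)) (hJ : ∀ u, J (J u) = -u)
    (hJi : ∀ u v, ⟪J u, v⟫_ℝ = -⟪u, J v⟫_ℝ) {B : V →L[ℝ] V →L[ℝ] V}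
    (h₁ : ∀ u v w, ⟪B u v, w⟫_ℝ = -⟪B v u, w⟫_ℝ)
    (h₂ : ∀ u v w, ⟪B u v, w⟫_ℝ = -⟪B u w, v⟫_ℝ) (u v w : V) :
    ⟪nijPart J B u v, w⟫_ℝ = (coeff₃₀ J e B * cplxVolume e ![u, v, w]).re := by
  rw [coeff₃₀, ← cplx₃_eq_cplxVolume he hJ h₁ h₂, nijPart_apply]
  simp [cplx₃, inner_add_left, inner_sub_left, hJi]
  ring

lemma sum_sq_nijPart {ι : Type*} [Fintype ι] (b : OrthonormalBasis ι ℝ V)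
    (he : ∀ j, J (e (j, 0)) = e (j, 1)) (hJ : ∀ u, J (J u) = -u)
    (hJi : ∀ u v, ⟪J u, v⟫_ℝ = -⟪u, J v⟫_ℝ) {B : V →L[ℝ] V →L[ℝ] V}
    (h₁ : ∀ u v w, ⟪B u v, w⟫_ℝ = -⟪B v u, w⟫_ℝ)
    (h₂ : ∀ u v w, ⟪B u v, w⟫_ℝ = -⟪B u w, v⟫_ℝ) :
    ∑ i, ∑ j, ∑ k, ⟪nijPart J B (b i) (b j), b k⟫_ℝ ^ 2
      = 24 * Complex.normSq (coeff₃₀ J e B) := by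
  rw [sum_sq_trilinear_basis_eq b e, ← sum_sq_re_mul_cplxVolume e]
  simp only [inner_nijPart he hJ hJi h₁ h₂]

lemma nijPart_eq_zero_iff (he : ∀ j, J (e (j, 0)) = e (j, 1)) (hJ : ∀ u, J (J u) = -u)
    (hJi : ∀ u v, ⟪J u, v⟫_ℝ = -⟪u, J v⟫_ℝ) {B : V →L[ℝ] V →L[ℝ] V}
    (h₁ : ∀ u v w, ⟪B u v, w⟫_ℝ = -⟪B v u, w⟫_ℝ)
    (h₂ : ∀ u v w, ⟪B u v, w⟫_ℝ = -⟪B u w, v⟫_ℝ) :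
    (∀ u v, nijPart J B u v = 0) ↔ coeff₃₀ J e B = 0 := by
  constructor
  · intro h
    have := sum_sq_nijPart e he hJ hJi h₁ h₂
    simpa [h] using this.symm
  · intro h u v
    refine ext_inner_right ℝ fun w ↦ ?_
    rw [inner_nijPart he hJ hJi h₁ h₂, h]
    simp

end NijenhuisPart

section Riemannian

variable {M : Type*} [TopologicalSpace M] [ChartedSpace (EuclideanSpace ℝ (Fin 6)) M]
  [IsManifold (𝓡 6) ∞ M] [RiemannianBundle (fun x : M ↦ Tan x)]
  [IsContMDiffRiemannianBundle (𝓡 6) ∞ (EuclideanSpace ℝ (Fin 6)) (fun x : M ↦ Tan x)] {x : M}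
  {J : Π x : M, Tan x →L[ℝ] Tan x} {Ψ : Π x : M, Tan x [⋀^Fin 3]→L[ℝ] ℂ}
  {cov : CovariantDerivative (𝓡 6) (EuclideanSpace ℝ (Fin 6)) (fun x : M ↦ Tan x)}

namespace IsACYT

omit [RiemannianBundle (fun x : M ↦ Tan x)]
  [IsContMDiffRiemannianBundle (𝓡 6) ∞ (EuclideanSpace ℝ (Fin 6)) (fun x : M ↦ Tan x)] in
lemma mlieBracket_eq {X Y : Π y : M, Tan y} (hX : DiffAt X x) (hY : DiffAt Y x) :
    VectorField.mlieBracket (𝓡 6) X Y x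
      = cov Y x (X x) - cov X x (Y x) - cov.torsion x (X x) (Y x) := by
  rw [cov.torsion_apply hX hY, sub_sub_cancel]

/-- Each bracket is a difference of covariant derivatives minus torsion; since `J` is parallel the
derivative terms cancel. -/
lemma nijenhuis_eq (h : IsACYT J Ψ cov) (u v : Tan x) :
    nijenhuis J x u v = nijPart (J x) (cov.torsion x) u v := by
  have hu := diffAt_ext u
  have hv := diffAt_ext v
  have hJu := h.su3.smooth_J.diffAt hu
  have hJv := h.su3.smooth_J.diffAt hv
  rw [nijenhuis, nijenhuisField, mlieBracket_eq (cov := cov) hJu hJv,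
    mlieBracket_eq (cov := cov) hu hv, mlieBracket_eq (cov := cov) hJu hv,
    mlieBracket_eq (cov := cov) hu hJv, h.cov_J hu, h.cov_J hv, h.cov_J hu, h.cov_J hv,
    nijPart_apply]
  simp only [ext_self, map_sub, h.su3.J_sq]
  abel

variable [T2Space M]

lemma diffAt_nijenhuis (h : IsACYT J Ψ cov) {Y Z : Π y : M, Tan y} (hY : DiffAt Y x)
    (hZ : DiffAt Z x) : DiffAt (fun y ↦ nijenhuis J y (Y y) (Z y)) x := by
  have hJ := h.su3.smooth_J
  have hT {Y Z : Π y : M, Tan y} (hY : DiffAt Y x) (hZ : DiffAt Z x) :=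
    diffAt_torsion h.smooth_cov hY hZ
  simp only [h.nijenhuis_eq, nijPart_apply]
  exact (((hT hY hZ).sub (hT (hJ.diffAt hY) (hJ.diffAt hZ))).add
    (hJ.diffAt (hT (hJ.diffAt hY) hZ))).add (hJ.diffAt (hT hY (hJ.diffAt hZ)))

/-- The covariant derivative of the Nijenhuis tensor. -/
lemma cov_nijenhuis (h : IsACYT J Ψ cov) {Y Z : Π y : M, Tan y} (hY : DiffAt Y x)
    (hZ : DiffAt Z x) (z : Tan x) :
    cov (fun y ↦ nijenhuis J y (Y y) (Z y)) x z - nijenhuis J x (cov Y x z) (Z x)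
      - nijenhuis J x (Y x) (cov Z x z)
      = nijPart (J x) (covTorsion h.smooth_cov x z) (Y x) (Z x) := by
  have hJ := h.su3.smooth_J
  have hT {Y Z : Π y : M, Tan y} (hY : DiffAt Y x) (hZ : DiffAt Z x) :=
    diffAt_torsion h.smooth_cov hY hZ
  have hJY := hJ.diffAt hY
  have hJZ := hJ.diffAt hZ
  have e₁ := covTorsion_apply h.smooth_cov z hJY hZ
  have e₂ := covTorsion_apply h.smooth_cov z hY hJZ
  have e₃ := covTorsion_apply h.smooth_cov z hJY hJZ
  rw [h.cov_J hY] at e₁ e₃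
  rw [h.cov_J hZ] at e₂ e₃
  have E : cov (fun y ↦ nijenhuis J y (Y y) (Z y)) x z
      = cov (fun y ↦ cov.torsion y (Y y) (Z y)) x z
        - cov (fun y ↦ cov.torsion y (J y (Y y)) (J y (Z y))) x z
        + J x (cov (fun y ↦ cov.torsion y (J y (Y y)) (Z y)) x z)
        + J x (cov (fun y ↦ cov.torsion y (Y y) (J y (Z y))) x z) := by
    rw [← h.cov_J (hT hJY hZ), ← h.cov_J (hT hY hJZ), ← cov_sub (hT hY hZ) (hT hJY hJZ),
      ← cov_add ((hT hY hZ).sub (hT hJY hJZ)) (hJ.diffAt (hT hJY hZ)),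
      ← cov_add (((hT hY hZ).sub (hT hJY hJZ)).add (hJ.diffAt (hT hJY hZ)))
        (hJ.diffAt (hT hY hJZ))]
    simp only [h.nijenhuis_eq, nijPart_apply]
  rw [E, nijPart_apply, covTorsion_apply h.smooth_cov z hY hZ, e₁, e₂, e₃, h.nijenhuis_eq,
    h.nijenhuis_eq, nijPart_apply, nijPart_apply]
  simp only [map_sub]
  abel

lemma isParallelTwoTensor_iff (h : IsACYT J Ψ cov) :
    IsParallelTwoTensor cov (nijenhuis J)
      ↔ ∀ (x : M) (z u v : Tan x), nijPart (J x) (covTorsion h.smooth_cov x z) u v = 0 := by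
  constructor
  · intro H x z u v
    have := H x z (ext u) (ext v) (diffAt_ext u) (diffAt_ext v)
    rw [h.cov_nijenhuis (diffAt_ext u) (diffAt_ext v)] at this
    simpa using this
  · intro H x z Y Z hY hZ
    rw [h.cov_nijenhuis hY hZ, H]

end IsACYT

end Riemannian

end SU3Torsion

end

noncomputable section

namespace SU3Torsion

section DirDeriv

variable {M : Type*} [TopologicalSpace M] [ChartedSpace (EuclideanSpace ℝ (Fin 6)) M] {x : M}
  {V W : Type*} [NormedAddCommGroup V] [NormedSpace ℝ V] [NormedAddCommGroup W] [NormedSpace ℝ W]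

lemma dirDeriv_clm (L : V →L[ℝ] W) {f : M → V} (hf : MDifferentiableAt (𝓡 6) 𝓘(ℝ, V) f x)
    (z : Tan x) : dirDeriv (fun y ↦ L (f y)) x z = L (dirDeriv f x z) := by
  have hL : MDifferentiableAt 𝓘(ℝ, V) 𝓘(ℝ, W) L (f x) := L.differentiableAt.mdifferentiableAt
  refine (mfderiv_comp_apply x hL hf z).trans ?_
  have : mfderiv 𝓘(ℝ, V) 𝓘(ℝ, W) L (f x) = L := by
    rw [mfderiv_eq_fderiv]; exact L.fderiv
  rw [this]
  rfl

lemma mdifferentiableAt_clm (L : V →L[ℝ] W) {f : M → V}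
    (hf : MDifferentiableAt (𝓡 6) 𝓘(ℝ, V) f x) :
    MDifferentiableAt (𝓡 6) 𝓘(ℝ, W) (fun y ↦ L (f y)) x :=
  MDifferentiableAt.comp x L.differentiableAt.mdifferentiableAt hf

lemma dirDeriv_mul {f g : M → ℂ} (hf : MDifferentiableAt (𝓡 6) 𝓘(ℝ, ℂ) f x)
    (hg : MDifferentiableAt (𝓡 6) 𝓘(ℝ, ℂ) g x) (z : Tan x) :
    dirDeriv (fun y ↦ f y * g y) x z = f x * dirDeriv g x z + dirDeriv f x z * g x := by
  have := (hf.hasMFDerivAt.mul' hg.hasMFDerivAt).mfderiv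
  exact congrArg (fun A : Tan x →L[ℝ] ℂ ↦ A z) this

lemma dirDeriv_normSq {f : M → ℂ} (hf : MDifferentiableAt (𝓡 6) 𝓘(ℝ, ℂ) f x) (z : Tan x) :
    dirDeriv (fun y ↦ Complex.normSq (f y)) x z
      = 2 * (starRingEnd ℂ (f x) * dirDeriv f x z).re := by
  have hc := mdifferentiableAt_clm Complex.conjCLE.toContinuousLinearMap hf
  have e : (fun y ↦ Complex.normSq (f y))
      = fun y ↦ Complex.reCLM (Complex.conjCLE.toContinuousLinearMap (f y) * f y) := by
    funext y; simp [Complex.normSq_apply]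
  rw [e, dirDeriv_clm Complex.reCLM
    (f := fun y ↦ Complex.conjCLE.toContinuousLinearMap (f y) * f y) (hc.mul hf), dirDeriv_mul hc hf, dirDeriv_clm _ hf]
  simp
  ring

/-- A function with vanishing derivative on a connected manifold is constant. -/
lemma exists_eq_const_of_dirDeriv_eq_zero [ConnectedSpace M] [IsManifold (𝓡 6) ∞ M] {f : M → V}
    (hf : ∀ y, MDifferentiableAt (𝓡 6) 𝓘(ℝ, V) f y) (h : ∀ y z, dirDeriv f y z = 0) :
    ∃ c, ∀ y, f y = c := by
  have loc : IsLocallyConstant f := by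
    rw [IsLocallyConstant.iff_eventually_eq]
    intro x
    set φ := extChartAt (𝓡 6) x
    have hopen : IsOpen φ.target := isOpen_extChartAt_target x
    obtain ⟨r, hr, hball⟩ := Metric.isOpen_iff.1 hopen (φ x) (mem_extChartAt_target x)
    have hF : ∀ q ∈ Metric.ball (φ x) r, HasFDerivAt (f ∘ φ.symm) (0 : _ →L[ℝ] V) q := by
      intro q hq
      have hs : MDifferentiableAt 𝓘(ℝ, EuclideanSpace ℝ (Fin 6)) (𝓡 6) φ.symm q :=
        ((contMDiffOn_extChartAt_symm (n := 1) x).contMDiffAt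
          (hopen.mem_nhds (hball hq))).mdifferentiableAt one_ne_zero
      have hz : mfderiv (𝓡 6) 𝓘(ℝ, V) f (φ.symm q) = 0 := by
        ext z
        exact h _ z
      have := (hf (φ.symm q)).hasMFDerivAt.comp q hs.hasMFDerivAt
      rw [hz, ContinuousLinearMap.zero_comp] at this
      exact hasMFDerivAt_iff_hasFDerivAt.1 this
    have key : ∀ q ∈ Metric.ball (φ x) r, (f ∘ φ.symm) q = (f ∘ φ.symm) (φ x) := by
      intro q hq
      refine Metric.isOpen_ball.is_const_of_fderiv_eq_zero (𝕜 := ℝ)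
        (convex_ball (φ x) r).isPreconnected
        (fun p hp ↦ (hF p hp).differentiableAt.differentiableWithinAt)
        (fun p hp ↦ (hF p hp).fderiv) hq (Metric.mem_ball_self hr)
    have hcont : ∀ᶠ y in nhds x, φ y ∈ Metric.ball (φ x) r :=
      (continuousAt_extChartAt x).eventually (Metric.ball_mem_nhds _ hr)
    filter_upwards [hcont, extChartAt_source_mem_nhds (I := 𝓡 6) x] with y hy hy'
    have := key _ hy
    rw [Function.comp_apply, Function.comp_apply, φ.left_inv hy', extChartAt_to_inv] at this
    exact this
  obtain ⟨x₀⟩ := (inferInstance : Nonempty M)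
  exact ⟨f x₀, fun y ↦ loc.apply_eq_of_isPreconnected isPreconnected_univ trivial trivial⟩

end DirDeriv

/-! ### The coefficient $f$ in $N=\mathrm{Re}(f\Psi)$ and its derivative -/

section Riemannian

variable {M : Type*} [TopologicalSpace M] [ChartedSpace (EuclideanSpace ℝ (Fin 6)) M]
  [IsManifold (𝓡 6) ∞ M] [RiemannianBundle (fun x : M ↦ Tan x)]
  {x : M} {J : Π x : M, Tan x →L[ℝ] Tan x} {Ψ : Π x : M, Tan x [⋀^Fin 3]→L[ℝ] ℂ}
  {cov : CovariantDerivative (𝓡 6) (EuclideanSpace ℝ (Fin 6)) (fun x : M ↦ Tan x)}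

namespace IsSU3Structure

lemma form_J (h : IsSU3Structure J Ψ) (u v w : Tan x) :
    Ψ x ![J x u, v, w] = Complex.I * Ψ x ![u, v, w] := by
  obtain ⟨e, he, hΨ⟩ := h.exists_adapted x
  have hc : ∀ k, cplxCoord e k (J x u) = Complex.I * cplxCoord e k u := by
    intro k
    have h₀ : ⟪e (k, 0), J x u⟫_ℝ = -⟪e (k, 1), u⟫_ℝ := by
      rw [← he, h.inner_J, neg_neg]
    have h₁ : ⟪e (k, 1), J x u⟫_ℝ = ⟪e (k, 0), u⟫_ℝ := by
      rw [← he, h.J_inner]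
    rw [cplxCoord, cplxCoord, h₀, h₁]
    push_cast
    linear_combination (-(⟪e (k, 1), u⟫_ℝ : ℂ)) * Complex.I_sq
  rw [hΨ, hΨ]
  simp [cplxVolume, Matrix.det_fin_three, hc]
  ring

end IsSU3Structure

variable [IsContMDiffRiemannianBundle (𝓡 6) ∞ (EuclideanSpace ℝ (Fin 6)) (fun x : M ↦ Tan x)]

namespace IsACYT

/-- The `(3,0)`-part of the torsion form is a multiple of `Ψ`; its real part is the Nijenhuis
tensor. -/
lemma exists_coeff (h : IsACYT J Ψ cov) :
    ∃ f : M → ℂ, (∀ (y : M) (u v w : Tan y),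
      ⟪nijenhuis J y u v, w⟫_ℝ = (f y * Ψ y ![u, v, w]).re) ∧
      ∀ y, normSqTensor (nijenhuis J) y = 24 * Complex.normSq (f y) := by
  choose e he hΨ using fun y ↦ h.su3.exists_adapted y
  refine ⟨fun y ↦ coeff₃₀ (J y) (e y) (cov.torsion y), fun y u v w ↦ ?_, fun y ↦ ?_⟩
  · rw [h.nijenhuis_eq, hΨ, inner_nijPart (he y) (h.su3.J_sq y) h.su3.inner_J torsion_swap₁₂
      h.torsion_swap₂₃]
  · simp only [normSqTensor, h.nijenhuis_eq]
    exact sum_sq_nijPart _ (he y) (h.su3.J_sq y) h.su3.inner_J torsion_swap₁₂ h.torsion_swap₂₃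

variable [T2Space M]

/-- This is the product rule for $\mathrm{Re}(f\Psi)$ with the coefficient of $\nabla T$ in place of
$df$, available before `f` is known to be differentiable. -/
lemma dirDeriv_inner_nijenhuis (h : IsACYT J Ψ cov)
    {e : OrthonormalBasis (Fin 3 × Fin 2) ℝ (Tan x)}
    (he : ∀ j, J x (e (j, 0)) = e (j, 1)) (hΨ : ∀ v, Ψ x v = cplxVolume e v) {f : M → ℂ}
    (hf : ∀ (y : M) (u v w : Tan y), ⟪nijenhuis J y u v, w⟫_ℝ = (f y * Ψ y ![u, v, w]).re)
    {A B C : Π y : M, Tan y} (hA : DiffAt A x) (hB : DiffAt B x) (hC : DiffAt C x) (z : Tan x) :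
    dirDeriv (fun y ↦ ⟪nijenhuis J y (A y) (B y), C y⟫_ℝ) x z
      = (coeff₃₀ (J x) e (covTorsion h.smooth_cov x z) * Ψ x ![A x, B x, C x]
        + f x * dirDeriv (fun y ↦ Ψ y ![A y, B y, C y]) x z).re := by
  have H := h.cov_nijenhuis hA hB z
  rw [sub_sub, sub_eq_iff_eq_add] at H
  rw [h.dirDeriv_inner (h.diffAt_nijenhuis hA hB) hC, H, h.dirDeriv_form hA hB hC, inner_add_left,
    inner_add_left, hf, hf, hf, inner_nijPart he (h.su3.J_sq x) h.su3.inner_J (h.dTor_swap₁₂ z)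
    (h.dTor_swap₂₃ z), ← hΨ]
  simp only [Complex.add_re, mul_add]
  ring

/-- No regularity of `f` is given: it comes from bases chosen point by point. Near `x` it is
recovered as a quotient of differentiable functions, the denominator `P` being $-1$ at `x`. -/
lemma dirDeriv_coeff (h : IsACYT J Ψ cov) {e : OrthonormalBasis (Fin 3 × Fin 2) ℝ (Tan x)}
    (he : ∀ j, J x (e (j, 0)) = e (j, 1)) (hΨ : ∀ v, Ψ x v = cplxVolume e v) {f : M → ℂ}
    (hf : ∀ (y : M) (u v w : Tan y), ⟪nijenhuis J y u v, w⟫_ℝ = (f y * Ψ y ![u, v, w]).re) :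
    MDifferentiableAt (𝓡 6) 𝓘(ℝ, ℂ) f x ∧
      ∀ z, dirDeriv f x z = coeff₃₀ (J x) e (covTorsion h.smooth_cov x z) := by
  set A := ext (e (0, 0))
  set B := ext (e (1, 0))
  set C := ext (e (2, 0))
  have hA : DiffAt A x := diffAt_ext _
  have hB : DiffAt B x := diffAt_ext _
  have hC : DiffAt C x := diffAt_ext _
  have hJA := h.su3.smooth_J.diffAt hA
  let P : M → ℂ := fun y ↦ Ψ y ![A y, B y, C y]
  have hP₀ : P x = -1 := by
    simp only [P, A, B, C, ext_self, hΨ, cplxVolume_basis]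
  have hP : MDifferentiableAt (𝓡 6) 𝓘(ℝ, ℂ) P x :=
    (h.su3.smoothAt_form (smoothAt_ext _ (mem_chart_source _ x))
      (smoothAt_ext _ (mem_chart_source _ x))
      (smoothAt_ext _ (mem_chart_source _ x))).mdifferentiableAt (by simp)
  let a : M → ℝ := fun y ↦ ⟪nijenhuis J y (A y) (B y), C y⟫_ℝ
  let b : M → ℝ := fun y ↦ ⟪nijenhuis J y (J y (A y)) (B y), C y⟫_ℝ
  have ha : MDifferentiableAt (𝓡 6) 𝓘(ℝ, ℝ) a x := (h.diffAt_nijenhuis hA hB).inner hC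
  have hb : MDifferentiableAt (𝓡 6) 𝓘(ℝ, ℝ) b x := (h.diffAt_nijenhuis hJA hB).inner hC
  have ha' := mdifferentiableAt_clm Complex.ofRealCLM ha
  have hb' := mdifferentiableAt_clm (Complex.I • Complex.ofRealCLM) hb
  -- Replacing $A$ by $JA$ multiplies $\Psi$ by $i$, so `b` is minus the imaginary part of $fP$.
  have hG : (fun y ↦ f y * P y)
      = fun y ↦ Complex.ofRealCLM (a y) - (Complex.I • Complex.ofRealCLM) (b y) := by
    funext y
    have e₁ : a y = (f y * P y).re := hf y _ _ _
    have e₂ : b y = (f y * (Complex.I * P y)).re := by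
      simp only [b, hf, h.su3.form_J, P]
    rw [e₁, e₂]
    apply Complex.ext
    · simp
    · simp; ring
  have hfP : MDifferentiableAt (𝓡 6) 𝓘(ℝ, ℂ) (fun y ↦ f y * P y) x := by
    rw [hG]; exact ha'.sub hb'
  have hfd : MDifferentiableAt (𝓡 6) 𝓘(ℝ, ℂ) f x := by
    have hne : ∀ᶠ y in nhds x, P y ≠ 0 :=
      hP.continuousAt.eventually_ne (by rw [hP₀]; simp)
    refine (hfP.div hP (by rw [hP₀]; simp)).congr_of_eventuallyEq ?_
    filter_upwards [hne] with y hy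
    simp [hy]
  refine ⟨hfd, fun z ↦ ?_⟩
  have d₁ := dirDeriv_mul hfd hP z
  rw [hG, dirDeriv_sub ha' hb', dirDeriv_clm _ ha, dirDeriv_clm _ hb] at d₁
  have da := h.dirDeriv_inner_nijenhuis he hΨ hf hA hB hC z
  have db := h.dirDeriv_inner_nijenhuis he hΨ hf hJA hB hC z
  have hI : dirDeriv (fun y ↦ Ψ y ![J y (A y), B y, C y]) x z = Complex.I * dirDeriv P x z := by
    rw [h.dirDeriv_form hJA hB hC, h.dirDeriv_form hA hB hC, h.cov_J hA]
    simp only [h.su3.form_J]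
    ring
  rw [hI, h.su3.form_J] at db
  change dirDeriv a x z = (_ * P x + f x * dirDeriv P x z).re at da
  change dirDeriv b x z = (_ * (Complex.I * P x) + _).re at db
  rw [da, db, hP₀] at d₁
  have d₂ : coeff₃₀ (J x) e (covTorsion h.smooth_cov x z) * (-1) + f x * dirDeriv P x z
      = f x * dirDeriv P x z + dirDeriv f x z * (-1) := by
    rw [← d₁]
    apply Complex.ext
    · simp
    · simp; ring
  linear_combination d₂

end IsACYT

end Riemannian

end SU3Torsion

end

noncomputable section

namespace SU3Torsion

/-! ### Differentiating traces of endomorphism fields -/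

section Trace

variable {M : Type*} [TopologicalSpace M] [ChartedSpace (EuclideanSpace ℝ (Fin 6)) M]
  [IsManifold (𝓡 6) ∞ M] {x : M}
  {cov : CovariantDerivative (𝓡 6) (EuclideanSpace ℝ (Fin 6)) (fun x : M ↦ Tan x)}

omit [IsManifold (𝓡 6) ∞ M] in
lemma dirDeriv_sum {ι V : Type*} [NormedAddCommGroup V] [NormedSpace ℝ V] {s : Finset ι}
    {f : ι → M → V} (hf : ∀ i ∈ s, MDifferentiableAt (𝓡 6) 𝓘(ℝ, V) (f i) x) (z : Tan x) :
    MDifferentiableAt (𝓡 6) 𝓘(ℝ, V) (fun y ↦ ∑ i ∈ s, f i y) x ∧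
      dirDeriv (fun y ↦ ∑ i ∈ s, f i y) x z = ∑ i ∈ s, dirDeriv (f i) x z := by
  classical
  induction s using Finset.induction_on with
  | empty =>
    simp only [Finset.sum_empty]
    exact ⟨mdifferentiableAt_const, by simp [dirDeriv, mvfderiv, mfderiv_const]⟩
  | insert a s ha ih =>
    simp only [Finset.sum_insert ha]
    have h₁ := hf a (Finset.mem_insert_self a s)
    obtain ⟨h₂, h₃⟩ := ih fun i hi ↦ hf i (Finset.mem_insert_of_mem hi)
    exact ⟨h₁.add h₂, by rw [dirDeriv_add h₁ h₂, h₃]⟩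

lemma cov_sum {ι : Type*} {s : Finset ι} {X : ι → Π y : M, Tan y}
    (hX : ∀ i ∈ s, DiffAt (X i) x) (z : Tan x) :
    cov (fun y ↦ ∑ i ∈ s, X i y) x z = ∑ i ∈ s, cov (X i) x z := by
  classical
  induction s using Finset.induction_on with
  | empty =>
    simp only [Finset.sum_empty]
    have := cov.isCovariantDerivativeOn.zero (x := x)
    exact congrArg (fun A ↦ A z) this
  | insert a s ha ih =>
    simp only [Finset.sum_insert ha]
    have h₁ := hX a (Finset.mem_insert_self a s)
    have h₂ : ∀ i ∈ s, DiffAt (X i) x := fun i hi ↦ hX i (Finset.mem_insert_of_mem hi)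
    rw [cov_add h₁ (DiffAt.sum h₂), ih h₂]

omit [IsManifold (𝓡 6) ∞ M] in
lemma _root_.Module.Basis.trace_eq_sum_repr {ι V : Type*} [Fintype ι] [AddCommGroup V] [Module ℝ V]
    (b : Module.Basis ι ℝ V) (B : V →ₗ[ℝ] V) :
    LinearMap.trace ℝ V B = ∑ i, b.repr (B (b i)) i := by
  classical
  rw [LinearMap.trace_eq_matrix_trace ℝ b, Matrix.trace]
  simp [LinearMap.toMatrix_apply]

variable (x) in
lemma exists_frame : ∃ (s : Fin 6 → Π y : M, Tan y) (c : Fin 6 → Π y : M, Tan y →ₗ[ℝ] ℝ),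
    (∀ i, DiffAt (s i) x) ∧
    (∀ Y : Π y : M, Tan y, DiffAt Y x → ∀ i,
      MDifferentiableAt (𝓡 6) 𝓘(ℝ, ℝ) (fun y ↦ c i y (Y y)) x) ∧
    (∀ i j, c i x (s j x) = if i = j then 1 else 0) ∧
    ∀ᶠ y in nhds x, (∀ v, v = ∑ i, c i y v • s i y) ∧
      ∀ B : Tan y →L[ℝ] Tan y, LinearMap.trace ℝ (Tan y) B = ∑ i, c i y (B (s i y)) := by
  let t := trivializationAt (EuclideanSpace ℝ (Fin 6)) (TangentSpace (𝓡 6) : M → Type) x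
  let b := (EuclideanSpace.basisFun (Fin 6) ℝ).toBasis
  have hx : x ∈ t.baseSet := FiberBundle.mem_baseSet_trivializationAt' x
  have hc : ∀ y (hy : y ∈ t.baseSet) (v : Tan y) i,
      t.localFrameCoeff (𝓡 6) b i y v = (t.basisAt b hy).repr v i := by
    intro y hy v i
    have := Bundle.Trivialization.localFrameCoeff_apply_of_mem_baseSet (I := 𝓡 6) t b hy (ext v) i
    rwa [ext_self] at this
  have hs : ∀ y (hy : y ∈ t.baseSet) i, t.localFrame b i y = t.basisAt b hy i := fun y hy i ↦
    Bundle.Trivialization.localFrame_apply_of_mem_baseSet _ _ hy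
  refine ⟨t.localFrame b, t.localFrameCoeff (𝓡 6) b, fun i ↦
    (contMDiffAt_localFrame_of_mem 1 t b i hx).mdifferentiableAt (by simp),
    fun Y hY i ↦ mdifferentiableAt_localFrameCoeff b hx hY i, fun i j ↦ ?_, ?_⟩
  · rw [hs x hx, hc x hx, Module.Basis.repr_self, Finsupp.single_apply]
    simp [eq_comm]
  · filter_upwards [t.open_baseSet.mem_nhds hx] with y hy
    refine ⟨fun v ↦ ?_, fun B ↦ ?_⟩
    · simp only [hc y hy, hs y hy]
      exact ((t.basisAt b hy).sum_repr v).symm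
    · simp only [hc y hy, hs y hy]
      exact (t.basisAt b hy).trace_eq_sum_repr _

/-- The derivative of the trace of an endomorphism field is the trace of its covariant
derivative. -/
lemma dirDeriv_trace {A : Π y : M, Tan y →L[ℝ] Tan y} {D : Tan x →L[ℝ] Tan x} {z : Tan x}
    (hA : ∀ Y : Π y : M, Tan y, DiffAt Y x → DiffAt (fun y ↦ A y (Y y)) x)
    (hD : ∀ Y : Π y : M, Tan y, DiffAt Y x →
      cov (fun y ↦ A y (Y y)) x z = A x (cov Y x z) + D (Y x)) :
    dirDeriv (fun y ↦ LinearMap.trace ℝ (Tan y) (A y)) x z = LinearMap.trace ℝ (Tan x) D := by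
  obtain ⟨s, c, hs, hc, hcs, near⟩ := exists_frame x
  have hcov : ∀ {Y : Π y : M, Tan y}, DiffAt Y x → ∀ i,
      c i x (cov Y x z) = dirDeriv (fun y ↦ c i y (Y y)) x z
        + ∑ j, c j x (Y x) * c i x (cov (s j) x z) := by
    intro Y hY i
    have hterm : ∀ j ∈ Finset.univ, DiffAt (fun y ↦ c j y (Y y) • s j y) x :=
      fun j _ ↦ DiffAt.smul (hc Y hY j) (hs j)
    rw [cov_congr (DiffAt.sum hterm) (near.mono fun y hy ↦ hy.1 (Y y)), cov_sum hterm, map_sum]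
    simp only [fun j ↦ cov_smul (cov := cov) (hc Y hY j) (hs j) z, map_add, map_smul, hcs,
      smul_eq_mul, Finset.sum_add_distrib]
    simp [add_comm]
  rw [dirDeriv_congr (near.mono fun y hy ↦ hy.2 (A y)),
    (dirDeriv_sum (fun i _ ↦ hc _ (hA _ (hs i)) i) z).2, near.self_of_nhds.2 D]
  have h₁ : ∀ i, dirDeriv (fun y ↦ c i y (A y (s i y))) x z
      = c i x (A x (cov (s i) x z)) + c i x (D (s i x))
        - ∑ j, c j x (A x (s i x)) * c i x (cov (s j) x z) := by
    intro i
    have := hcov (hA _ (hs i)) i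
    rw [hD _ (hs i), map_add] at this
    linarith
  have h₂ : ∀ i, c i x (A x (cov (s i) x z))
      = ∑ j, c i x (A x (s j x)) * c j x (cov (s i) x z) := by
    intro i
    conv_lhs => rw [near.self_of_nhds.1 (cov (s i) x z)]
    rw [map_sum, map_sum]
    refine Finset.sum_congr rfl fun j _ ↦ ?_
    rw [map_smul, map_smul, smul_eq_mul, mul_comm]
  simp only [h₁, h₂, Finset.sum_sub_distrib, Finset.sum_add_distrib]
  -- The two double sums of connection coefficients agree after exchanging the indices; what is left
  -- is the trace of `D`.
  rw [Finset.sum_comm]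
  ring

end Trace

end SU3Torsion

end

noncomputable section

namespace SU3Torsion

section Trace

variable {V : Type*} [NormedAddCommGroup V] [InnerProductSpace ℝ V] {J : V →L[ℝ] V}

/-- The trace of `J ∘ B / 2` for a skew-symmetric `B` in an adapted basis. -/
lemma trace_half_J_comp {e : OrthonormalBasis (Fin 3 × Fin 2) ℝ V}
    (he : ∀ j, J (e (j, 0)) = e (j, 1)) (hJ : ∀ u, J (J u) = -u)
    (hJi : ∀ u v, ⟪J u, v⟫_ℝ = -⟪u, J v⟫_ℝ) {B : V →L[ℝ] V}
    (hB : ∀ u v, ⟪B u, v⟫_ℝ = -⟪B v, u⟫_ℝ) :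
    LinearMap.trace ℝ V ((1 / 2 : ℝ) • (J ∘L B) : V →L[ℝ] V)
      = -∑ k, ⟪B (e (k, 0)), J (e (k, 0))⟫_ℝ := by
  rw [LinearMap.trace_eq_sum_inner _ e, ← Finset.sum_neg_distrib]
  have := sum_adapted (e := e) (F := fun u ↦ ⟪u, ((1 / 2 : ℝ) • (J ∘L B)) u⟫_ℝ) he
  refine this.trans (Finset.sum_congr rfl fun k _ ↦ ?_)
  have h₁ : ∀ u, ⟪u, ((1 / 2 : ℝ) • (J ∘L B)) u⟫_ℝ = -(1 / 2) * ⟪B u, J u⟫_ℝ := by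
    intro u
    have : ⟪u, J (B u)⟫_ℝ = -⟪B u, J u⟫_ℝ := by
      rw [real_inner_comm, hJi]
    simp [inner_smul_right, this]
  rw [h₁, h₁, hJ, inner_neg_right, hB (J _)]
  ring

end Trace

/-! ### The Lee form and its exterior derivative -/

section Riemannian

variable {M : Type*} [TopologicalSpace M] [ChartedSpace (EuclideanSpace ℝ (Fin 6)) M]
  [IsManifold (𝓡 6) ∞ M] [RiemannianBundle (fun x : M ↦ Tan x)]
  [IsContMDiffRiemannianBundle (𝓡 6) ∞ (EuclideanSpace ℝ (Fin 6)) (fun x : M ↦ Tan x)]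
  {x : M} {J : Π x : M, Tan x →L[ℝ] Tan x} {Ψ : Π x : M, Tan x [⋀^Fin 3]→L[ℝ] ℂ}
  {cov : CovariantDerivative (𝓡 6) (EuclideanSpace ℝ (Fin 6)) (fun x : M ↦ Tan x)}

namespace IsACYT

/-- Metric compatibility and skew torsion give $\nabla^g=\nabla-\frac12T$; with commuting fields the
Koszul formula has no bracket terms. -/
lemma koszul_ext (h : IsACYT J Ψ cov) (u v z : Tan x) :
    koszul (ext v) (ext u) (ext z) x
      = ⟪cov (ext u) x v - (1 / 2 : ℝ) • cov.torsion x v u, z⟫_ℝ := by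
  have hx := mem_chart_source (EuclideanSpace ℝ (Fin 6)) x
  have tor : ∀ a b : Tan x, cov.torsion x a b = cov (ext b) x a - cov (ext a) x b := by
    intro a b
    have := torsion_ext (cov := cov) a b hx
    simpa using this
  have t₁ := congrArg (fun q ↦ ⟪q, u⟫_ℝ) (tor v z)
  have t₂ := congrArg (fun q ↦ ⟪q, v⟫_ℝ) (tor u z)
  have t₃ := congrArg (fun q ↦ ⟪q, z⟫_ℝ) (tor u v)
  have s₁ := h.torsion_swap₂₃ v z u
  have s₂ := h.torsion_swap₂₃ u z v
  have s₃ := torsion_swap₁₂ (cov := cov) u v z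
  simp only [inner_sub_left] at t₁ t₂ t₃
  simp only [koszul, mlieBracket_ext _ _ hx, h.dirDeriv_inner (diffAt_ext _) (diffAt_ext _),
    ext_self, inner_zero_left, inner_sub_left, inner_smul_left, real_inner_comm (cov (ext z) x _),
    real_inner_comm (cov (ext u) x z)]
  simp
  linarith

lemma leviCivita_ext (h : IsACYT J Ψ cov) (u v : Tan x) :
    leviCivita (ext u) x v = cov (ext u) x v - (1 / 2 : ℝ) • cov.torsion x v u := by
  simp only [leviCivita, h.koszul_ext]
  rw [← (onb x).sum_repr' (cov (ext u) x v - (1 / 2 : ℝ) • cov.torsion x v u)]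
  simp only [(onb x).sum_repr', real_inner_comm]

lemma leviCivitaForm_kahlerForm (h : IsACYT J Ψ cov) (v u w : Tan x) :
    leviCivitaForm (kahlerForm J) x v u w
      = (1 / 2) * (⟪cov.torsion x v u, J x w⟫_ℝ + ⟪u, J x (cov.torsion x v w)⟫_ℝ) := by
  have := h.dirDeriv_inner (diffAt_ext u) (h.su3.smooth_J.diffAt (diffAt_ext w)) v
  simp only [leviCivitaForm, kahlerForm, this, h.leviCivita_ext, h.cov_J (diffAt_ext w), ext_self,
    map_sub, map_smul, inner_sub_left, inner_sub_right, inner_smul_left, inner_smul_right]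
  simp
  ring

/-- The bases `onb` need not vary regularly with the point. A trace does not depend on them and can
be differentiated. -/
lemma leeForm_eq_trace (h : IsACYT J Ψ cov) (v : Tan x) :
    leeForm J x v = LinearMap.trace ℝ (Tan x)
      ((1 / 2 : ℝ) • (J x ∘L cov.torsion x (J x v)) : Tan x →L[ℝ] Tan x) := by
  rw [leeForm, codiffTwo, LinearMap.trace_eq_sum_inner _ (onb x), ← Finset.sum_neg_distrib]
  refine Finset.sum_congr rfl fun i _ ↦ ?_
  rw [h.leviCivitaForm_kahlerForm, cov.torsion_self, cov.torsion_antisymm]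
  simp [inner_smul_right]

variable [T2Space M]

lemma dirDeriv_leeForm (h : IsACYT J Ψ cov) (u v : Tan x) :
    dirDeriv (fun y ↦ leeForm J y (ext v y)) x u = LinearMap.trace ℝ (Tan x)
      ((1 / 2 : ℝ) • (J x ∘L (covTorsion h.smooth_cov x u (J x v)
        + cov.torsion x (J x (cov (ext v) x u)))) : Tan x →L[ℝ] Tan x) := by
  have hJ := h.su3.smooth_J
  have hv := diffAt_ext v
  have half : MDifferentiableAt (𝓡 6) 𝓘(ℝ, ℝ) (fun _ : M ↦ (1 / 2 : ℝ)) x :=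
    mdifferentiableAt_const
  have hT : ∀ Y : Π y : M, Tan y, DiffAt Y x →
      DiffAt (fun y ↦ J y (cov.torsion y (J y (ext v y)) (Y y))) x := fun Y hY ↦
    hJ.diffAt (diffAt_torsion h.smooth_cov (hJ.diffAt hv) hY)
  simp only [h.leeForm_eq_trace]
  refine dirDeriv_trace (cov := cov) (fun Y hY ↦ DiffAt.smul half (hT Y hY)) fun Y hY ↦ ?_
  have d : dirDeriv (fun _ : M ↦ (1 / 2 : ℝ)) x u = 0 := by
    simp [dirDeriv, mvfderiv, mfderiv_const]
  have e₁ := cov_smul (cov := cov) half (hT Y hY) u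
  have e₂ := covTorsion_apply h.smooth_cov u (hJ.diffAt hv) hY
  rw [h.cov_J hv, ext_self] at e₂
  rw [h.cov_J (diffAt_torsion h.smooth_cov (hJ.diffAt hv) hY), d, zero_smul, add_zero] at e₁
  refine e₁.trans ?_
  simp only [ext_self, smul_apply, ContinuousLinearMap.comp_apply, add_apply, e₂]
  rw [← smul_add, ← map_add]
  congr 2
  abel

/-- The coordinate fields commute, so the leftover terms $\nabla_uv-\nabla_vu$ from the derivatives
of $\theta$ combine into $T(u,v)$. -/
lemma extDerivOne_leeForm (h : IsACYT J Ψ cov)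
    {e : OrthonormalBasis (Fin 3 × Fin 2) ℝ (Tan x)} (he : ∀ j, J x (e (j, 0)) = e (j, 1))
    (u v : Tan x) :
    extDerivOne (leeForm J) x u v
      = -∑ k, (h.dTor x u (J x v) (e (k, 0)) (J x (e (k, 0)))
          - h.dTor x v (J x u) (e (k, 0)) (J x (e (k, 0))))
        - ∑ k, ⟪cov.torsion x (J x (cov.torsion x u v)) (e (k, 0)), J x (e (k, 0))⟫_ℝ := by
  have hx := mem_chart_source (EuclideanSpace ℝ (Fin 6)) x
  have tor : cov.torsion x u v = cov (ext v) x u - cov (ext u) x v := by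
    have := torsion_ext (cov := cov) u v hx
    simpa using this
  have key : ∀ a b : Tan x, dirDeriv (fun y ↦ leeForm J y (ext b y)) x a
      = -∑ k, h.dTor x a (J x b) (e (k, 0)) (J x (e (k, 0)))
        - ∑ k, ⟪cov.torsion x (J x (cov (ext b) x a)) (e (k, 0)), J x (e (k, 0))⟫_ℝ := by
    intro a b
    rw [h.dirDeriv_leeForm, trace_half_J_comp he (h.su3.J_sq x) h.su3.inner_J]
    · simp only [add_apply, inner_add_left, Finset.sum_add_distrib, dTor]
      ring
    · intro p q
      simp only [add_apply, inner_add_left]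
      rw [h.torsion_swap₂₃ _ p q]
      have := h.dTor_swap₂₃ a (J x b) p q
      simp only [dTor] at this
      rw [this]
      ring
  have zero : leeForm J x (0 : Tan x) = 0 := by
    rw [h.leeForm_eq_trace]
    simp
  rw [extDerivOne, mlieBracket_ext u v hx, zero, key, key, tor]
  simp only [map_sub, sub_apply, inner_sub_left, Finset.sum_sub_distrib]
  ring

lemma extDerivOne_leeForm_eq (h : IsACYT J Ψ cov)
    {e : OrthonormalBasis (Fin 3 × Fin 2) ℝ (Tan x)} (he : ∀ j, J x (e (j, 0)) = e (j, 1))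
    (u v : Tan x) :
    extDerivOne (leeForm J) x u v
      = -∑ k, (h.dTor x u (J x v) (e (k, 0)) (J x (e (k, 0)))
          - h.dTor x v (J x u) (e (k, 0)) (J x (e (k, 0))))
        - ∑ k, ∑ a, (⟪cov.torsion x u v, e (a, 0)⟫_ℝ
            * ⟪cov.torsion x (J x (e (a, 0))) (e (k, 0)), J x (e (k, 0))⟫_ℝ
          - ⟪cov.torsion x u v, J x (e (a, 0))⟫_ℝ
            * ⟪cov.torsion x (e (a, 0)) (e (k, 0)), J x (e (k, 0))⟫_ℝ) := by
  have hJT : J x (cov.torsion x u v) = ∑ a, (⟪cov.torsion x u v, e (a, 0)⟫_ℝ • J x (e (a, 0))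
      - ⟪cov.torsion x u v, J x (e (a, 0))⟫_ℝ • e (a, 0)) := by
    conv_lhs => rw [eq_sum_adapted he (cov.torsion x u v)]
    simp only [← he, map_sum, map_add, map_smul, h.su3.J_sq, smul_neg, sub_eq_add_neg,
      real_inner_comm (cov.torsion x u v)]
  rw [h.extDerivOne_leeForm he]
  congr 1
  refine Finset.sum_congr rfl fun k _ ↦ ?_
  rw [hJT]
  simp only [map_sum, map_sub, map_smul, FunLike.coe_sum, Finset.sum_apply, sub_apply,
    smul_apply, sum_inner, inner_sub_left, inner_smul_left]
  simp

end IsACYT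

end Riemannian

end SU3Torsion

end

noncomputable section

namespace SU3Torsion

/-! ### Equivalence of the three conditions -/

section Riemannian

variable {M : Type*} [TopologicalSpace M] [T2Space M]
  [ChartedSpace (EuclideanSpace ℝ (Fin 6)) M]
  [IsManifold (𝓡 6) ∞ M] {x : M} {J : Π x : M, Tan x →L[ℝ] Tan x}
  {cov : CovariantDerivative (𝓡 6) (EuclideanSpace ℝ (Fin 6)) (fun x : M ↦ Tan x)}

lemma covTorsion_add (hcov : CovariantDerivative.ContMDiffCovariantDerivative cov ∞)
    (z z' : Tan x) : covTorsion hcov x (z + z') = covTorsion hcov x z + covTorsion hcov x z' := by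
  ext1 u
  ext1 v
  simp only [covTorsion_eq, map_add, add_apply]
  abel

lemma covTorsion_smul (hcov : CovariantDerivative.ContMDiffCovariantDerivative cov ∞)
    (c : ℝ) (z : Tan x) : covTorsion hcov x (c • z) = c • covTorsion hcov x z := by
  ext1 u
  ext1 v
  simp only [covTorsion_eq, map_smul, smul_apply, smul_sub]

variable [RiemannianBundle (fun x : M ↦ Tan x)]
  [IsContMDiffRiemannianBundle (𝓡 6) ∞ (EuclideanSpace ℝ (Fin 6)) (fun x : M ↦ Tan x)]
  {Ψ : Π x : M, Tan x [⋀^Fin 3]→L[ℝ] ℂ}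

namespace IsACYT

/-- The derivative of the coefficient of the `(3,0)`-part of the torsion, as a linear form. -/
def coeffDeriv (h : IsACYT J Ψ cov) (e : OrthonormalBasis (Fin 3 × Fin 2) ℝ (Tan x)) :
    Tan x →ₗ[ℝ] ℂ where
  toFun z := coeff₃₀ (J x) e (covTorsion h.smooth_cov x z)
  map_add' z z' := by
    simp only [coeff₃₀, cplx₃, covTorsion_add, add_apply, inner_add_left]
    push_cast
    ring
  map_smul' c z := by
    simp only [coeff₃₀, cplx₃, covTorsion_smul, smul_apply, inner_smul_left, RingHom.id_apply,
      Complex.real_smul]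
    simp
    ring

variable {e : OrthonormalBasis (Fin 3 × Fin 2) ℝ (Tan x)}

lemma cauchyRiemann_part₂₀ (h : IsACYT J Ψ cov) (he : ∀ j, J x (e (j, 0)) = e (j, 1))
    (hΨ : ∀ v, Ψ x v = cplxVolume e v) (k : Fin 3) :
    h.coeffDeriv e (e (k, 0)) - Complex.I * h.coeffDeriv e (J x (e (k, 0))) = 0 ∧
      part₂₀ (J x) (extDerivOne (leeForm J) x) (e (k + 1, 0)) (e (k + 2, 0))
        = h.coeffDeriv e (e (k, 0)) := by
  have := (h.bianchiData he hΨ).cauchyRiemann_part₂₀ (δ := h.coeffDeriv e)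
    (β := extDerivOne (leeForm J) x) (fun z ↦ (neg_neg _).symm)
    (fun u v ↦ h.extDerivOne_leeForm_eq he u v) (k + 1)
  have e₁ : k + 1 + 2 = k := by fin_cases k <;> rfl
  have e₂ : k + 1 + 1 = k + 2 := by fin_cases k <;> rfl
  rwa [e₁, e₂] at this

/-- The Cauchy-Riemann equations determine the derivative along $Je_k$ from that along $e_k$. -/
lemma coeffDeriv_eq_zero (h : IsACYT J Ψ cov) (he : ∀ j, J x (e (j, 0)) = e (j, 1))
    (hΨ : ∀ v, Ψ x v = cplxVolume e v) (h₀ : ∀ k, h.coeffDeriv e (e (k, 0)) = 0) :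
    h.coeffDeriv e = 0 := by
  refine e.toBasis.ext fun i ↦ ?_
  obtain ⟨k, s⟩ := i
  rw [OrthonormalBasis.coe_toBasis]
  fin_cases s
  · exact h₀ k
  · have := (h.cauchyRiemann_part₂₀ he hΨ k).1
    rw [h₀ k, he] at this
    simpa using this

lemma extDerivOne_add (h : IsACYT J Ψ cov) (u v w : Tan x) :
    extDerivOne (leeForm J) x (u + v) w
      = extDerivOne (leeForm J) x u w + extDerivOne (leeForm J) x v w := by
  obtain ⟨e, he, -⟩ := h.su3.exists_adapted x
  simp only [h.extDerivOne_leeForm he, dTor, map_add, covTorsion_add, add_apply,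
    inner_add_left, Finset.sum_add_distrib, Finset.sum_sub_distrib]
  ring

lemma extDerivOne_smul (h : IsACYT J Ψ cov) (c : ℝ) (u w : Tan x) :
    extDerivOne (leeForm J) x (c • u) w = c * extDerivOne (leeForm J) x u w := by
  obtain ⟨e, he, -⟩ := h.su3.exists_adapted x
  simp only [h.extDerivOne_leeForm he, dTor, map_smul, covTorsion_smul, smul_apply,
    inner_smul_left, Finset.sum_sub_distrib, conj_trivial, ← Finset.mul_sum]
  ring

lemma extDerivOne_swap (h : IsACYT J Ψ cov) (u v : Tan x) :
    extDerivOne (leeForm J) x u v = -extDerivOne (leeForm J) x v u := by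
  obtain ⟨e, he, -⟩ := h.su3.exists_adapted x
  rw [h.extDerivOne_leeForm he, h.extDerivOne_leeForm he, cov.torsion_antisymm u v]
  simp only [map_neg, FunLike.coe_neg, Pi.neg_apply, inner_neg_left, Finset.sum_sub_distrib,
    Finset.sum_neg_distrib]
  ring

lemma extDerivOne_neg (h : IsACYT J Ψ cov) (u v : Tan x) :
    extDerivOne (leeForm J) x (-u) v = -extDerivOne (leeForm J) x u v := by
  have := h.extDerivOne_smul (-1) u v
  simpa using this

lemma coeffDeriv_eq_zero_iff (h : IsACYT J Ψ cov) (he : ∀ j, J x (e (j, 0)) = e (j, 1))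
    (hΨ : ∀ v, Ψ x v = cplxVolume e v) :
    h.coeffDeriv e = 0 ↔ ∀ u v, part₂₀ (J x) (extDerivOne (leeForm J) x) u v = 0 := by
  constructor
  · intro h₀
    refine part₂₀_eq_zero he (h.su3.J_sq x) h.extDerivOne_add h.extDerivOne_smul
      h.extDerivOne_swap fun k ↦ ?_
    have := (h.cauchyRiemann_part₂₀ he hΨ (k + 2)).2
    have e₁ : k + 2 + 1 = k := by fin_cases k <;> rfl
    have e₂ : k + 2 + 2 = k + 1 := by fin_cases k <;> rfl
    rw [e₁, e₂] at this
    rw [this, h₀, LinearMap.zero_apply]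
  · intro h₀
    exact h.coeffDeriv_eq_zero he hΨ fun k ↦ by
      rw [← (h.cauchyRiemann_part₂₀ he hΨ k).2, h₀]

lemma part₂₀_eq_zero_iff (h : IsACYT J Ψ cov) :
    (∀ u v, part₂₀ (J x) (extDerivOne (leeForm J) x) u v = 0) ↔
      ∀ u v, extDerivOne (leeForm J) x u v = extDerivOne (leeForm J) x (J x u) (J x v) := by
  constructor
  · intro H u v
    have := congrArg Complex.re (H u v)
    simp only [part₂₀] at this
    simp at this
    linarith
  · intro H u v
    have h₁ := H u v
    -- Invariance at $(Ju,v)$ gives $\beta(Ju,v)=-\beta(u,Jv)$, which removes the imaginary part.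
    have h₂ := H (J x u) v
    rw [h.su3.J_sq, h.extDerivOne_neg] at h₂
    rw [part₂₀, h₁, h₂]
    simp

lemma coeffDeriv_eq_zero_iff_nijPart (h : IsACYT J Ψ cov) (he : ∀ j, J x (e (j, 0)) = e (j, 1)) :
    h.coeffDeriv e = 0 ↔ ∀ z u v, nijPart (J x) (covTorsion h.smooth_cov x z) u v = 0 := by
  have key : ∀ z, (∀ u v, nijPart (J x) (covTorsion h.smooth_cov x z) u v = 0)
      ↔ h.coeffDeriv e z = 0 := fun z ↦
    nijPart_eq_zero_iff he (h.su3.J_sq x) h.su3.inner_J (h.dTor_swap₁₂ z) (h.dTor_swap₂₃ z)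
  simp only [key, LinearMap.ext_iff, LinearMap.zero_apply]

lemma invariant_iff_isParallel (h : IsACYT J Ψ cov) :
    (∀ (x : M) (u v : Tan x), extDerivOne (leeForm J) x u v
      = extDerivOne (leeForm J) x (J x u) (J x v)) ↔ IsParallelTwoTensor cov (nijenhuis J) := by
  rw [h.isParallelTwoTensor_iff]
  refine forall_congr' fun x ↦ ?_
  obtain ⟨e, he, hΨ⟩ := h.su3.exists_adapted x
  rw [← h.part₂₀_eq_zero_iff, ← h.coeffDeriv_eq_zero_iff he hΨ,
    h.coeffDeriv_eq_zero_iff_nijPart he]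

lemma isParallel_of_normSq_eq_const (h : IsACYT J Ψ cov) {c : ℝ}
    (hc : ∀ x, normSqTensor (nijenhuis J) x = c) : IsParallelTwoTensor cov (nijenhuis J) := by
  obtain ⟨f, hf, hN⟩ := h.exists_coeff
  rw [h.isParallelTwoTensor_iff]
  intro x
  obtain ⟨e, he, hΨ⟩ := h.su3.exists_adapted x
  rw [← h.coeffDeriv_eq_zero_iff_nijPart he]
  obtain ⟨hfd, hdf⟩ := h.dirDeriv_coeff he hΨ hf
  have hn : (fun y ↦ Complex.normSq (f y)) = fun _ ↦ c / 24 := by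
    funext y
    have := (hN y).symm.trans (hc y)
    linarith
  have hre : ∀ z, (starRingEnd ℂ (f x) * h.coeffDeriv e z).re = 0 := by
    intro z
    have := dirDeriv_normSq hfd z
    rw [hn, hdf] at this
    have d : dirDeriv (fun _ : M ↦ c / 24) x z = 0 := by
      simp [dirDeriv, mvfderiv, mfderiv_const]
    rw [d] at this
    change 0 = 2 * (starRingEnd ℂ (f x) * h.coeffDeriv e z).re at this
    linarith
  -- As $|f|$ is constant, one zero forces $f\equiv0$; otherwise $\bar f(x)$ can be cancelled.
  by_cases hfx : f x = 0
  · have hf₀ : f = fun _ ↦ 0 := by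
      funext y
      have h₁ := congrFun hn x
      have h₂ := congrFun hn y
      rw [hfx, map_zero] at h₁
      rw [← h₁] at h₂
      exact Complex.normSq_eq_zero.1 h₂
    ext z
    have : dirDeriv f x z = h.coeffDeriv e z := hdf z
    rw [← this, hf₀]
    simp [dirDeriv, mvfderiv, mfderiv_const]
  · refine h.coeffDeriv_eq_zero he hΨ fun k ↦ ?_
    have hCR := (h.cauchyRiemann_part₂₀ he hΨ k).1
    have h₁ := hre (e (k, 0))
    have h₂ := hre (J x (e (k, 0)))
    have hJ : h.coeffDeriv e (J x (e (k, 0))) = -Complex.I * h.coeffDeriv e (e (k, 0)) := by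
      linear_combination Complex.I * hCR + h.coeffDeriv e (J x (e (k, 0))) * Complex.I_sq
    rw [hJ, show starRingEnd ℂ (f x) * (-Complex.I * h.coeffDeriv e (e (k, 0)))
      = -Complex.I * (starRingEnd ℂ (f x) * h.coeffDeriv e (e (k, 0))) by ring] at h₂
    -- Along $Je_k$ the derivative gains a factor $-i$, so `h₂` is the vanishing of the imaginary
    -- part and `h₁` that of the real part.
    have h₃ : starRingEnd ℂ (f x) * h.coeffDeriv e (e (k, 0)) = 0 := by
      apply Complex.ext
      · exact h₁
      · simpa using h₂
    exact (mul_eq_zero.1 h₃).resolve_left (by simpa using hfx)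

lemma exists_normSq_eq_const [ConnectedSpace M] (h : IsACYT J Ψ cov)
    (hN : IsParallelTwoTensor cov (nijenhuis J)) :
    ∃ c : ℝ, ∀ x, normSqTensor (nijenhuis J) x = c := by
  obtain ⟨f, hf, hNf⟩ := h.exists_coeff
  rw [h.isParallelTwoTensor_iff] at hN
  have H : ∀ x, MDifferentiableAt (𝓡 6) 𝓘(ℝ, ℂ) f x ∧ ∀ z, dirDeriv f x z = 0 := by
    intro x
    obtain ⟨e, he, hΨ⟩ := h.su3.exists_adapted x
    obtain ⟨hfd, hdf⟩ := h.dirDeriv_coeff he hΨ hf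
    refine ⟨hfd, fun z ↦ (hdf z).trans ?_⟩
    exact LinearMap.congr_fun ((h.coeffDeriv_eq_zero_iff_nijPart he).2 (hN x)) z
  obtain ⟨c, hc⟩ := exists_eq_const_of_dirDeriv_eq_zero (fun x ↦ (H x).1) (fun x ↦ (H x).2)
  exact ⟨24 * Complex.normSq c, fun x ↦ by rw [hNf, hc]⟩

end IsACYT

/-- Integrability makes the norm of $N$ constantly zero, so b) ⇒ c) ⇒ a) applies; no connectedness
enters these implications. -/
lemma IsCYT.isTypeOneOne (h : IsCYT J Ψ cov) (x : M) :
    IsTypeOneOne (J x) (extDerivOne (leeForm J) x) := by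
  have hc : ∀ x, normSqTensor (nijenhuis J) x = 0 := fun x ↦ by
    simp [normSqTensor, h.integrable]
  exact h.acyt.part₂₀_eq_zero_iff.2
    (h.acyt.invariant_iff_isParallel.2 (h.acyt.isParallel_of_normSq_eq_const hc) x)

end Riemannian

end SU3Torsion

end

theorem mainTheorem8 {M : Type*} [TopologicalSpace M] [T2Space M] [SecondCountableTopology M]
    [ConnectedSpace M] [ChartedSpace (EuclideanSpace ℝ (Fin 6)) M] [IsManifold (𝓡 6) ∞ M]
    [RiemannianBundle (fun x : M ↦ Tan x)]
    [IsContMDiffRiemannianBundle (𝓡 6) ∞ (EuclideanSpace ℝ (Fin 6)) (fun x : M ↦ Tan x)]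
    (J : Π x : M, Tan x →L[ℝ] Tan x) (Ψ : Π x : M, Tan x [⋀^Fin 3]→L[ℝ] ℂ)
    (cov : CovariantDerivative (𝓡 6) (EuclideanSpace ℝ (Fin 6)) (fun x : M ↦ Tan x)) :
    (SU3Torsion.IsACYT J Ψ cov →
      List.TFAE [
        ∀ (x : M) (u v : Tan x),
          SU3Torsion.extDerivOne (SU3Torsion.leeForm J) x u v
            = SU3Torsion.extDerivOne (SU3Torsion.leeForm J) x (J x u) (J x v),
        ∃ c : ℝ, ∀ x : M, SU3Torsion.normSqTensor (SU3Torsion.nijenhuis J) x = c,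
        SU3Torsion.IsParallelTwoTensor cov (SU3Torsion.nijenhuis J)]) ∧
    (SU3Torsion.IsCYT J Ψ cov →
      ∀ x : M, SU3Torsion.IsTypeOneOne (J x)
        (SU3Torsion.extDerivOne (SU3Torsion.leeForm J) x)) := by
  refine ⟨fun h ↦ ?_, fun h ↦ h.isTypeOneOne⟩
  tfae_have 1 ↔ 3 := h.invariant_iff_isParallel
  tfae_have 2 → 3 := fun ⟨_, hc⟩ ↦ h.isParallel_of_normSq_eq_const hc
  tfae_have 3 → 2 := h.exists_normSq_eq_const
  tfae_finish
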